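/- Let $M\subset\mathbb C^k$ be compact and let $m$ be a Borel probability measure on $M$. For $\lambda\in M$ let $H_\lambda=H_\lambda^{(r)}\circ\cdots\circ H_\lambda^{(1)}:\mathbb C^2\to\mathbb C^2$, where $r\ge1$, $H^{(j)}_\lambda(x,y)=(y,\,p_{j,\lambda}(y)-a_j(\lambda)x)$, $p_{j,\lambda}$ is a monic polynomial of degree $d_j\ge2$ (independent of $\lambda$) whose coefficients are continuous in $\lambda\in M$, and $a_j:M\to\mathbb C\setminus\{0\}$ is continuous. Put $d=d_1\cdots d_r$, $X=M\times M\times\cdots$ with the product topology, and $\overline m=m\times m\times\cdots$. For $\Lambda=(\lambda_1,\lambda_2,\dots)\in X$ and $\lambda\in M$ put $\lambda\Lambda=(\lambda,\lambda_1,\lambda_2,\dots)$, $H_{n,\Lambda}^{\pm}=H_{\lambda_n}^{\pm1}\circ\cdots\circ H_{\lambda_1}^{\pm1}$ ($H_{0,\Lambda}^\pm=\mathrm{id}$), $$G^\pm_\Lambda(z)=\lim_{n\to\infty}\frac1{d^n}\log^+\|H^\pm_{n,\Lambda}(z)\|,\qquad EG^\pm(z)=\int_X G^\pm_\Lambda(z)\,d\overline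 m(\Lambda),$$ $$K^\pm_\Lambda=\{z\in\mathbb C^2:(H^\pm_{n,\Lambda}(z))_{n\ge0}\text{ is bounded}\},\qquad J_\Lambda^\pm=\partial K_\Lambda^\pm,$$ $$\mu_\Lambda^\pm=\frac1{2\pi}dd^cG_\Lambda^\pm,\qquad \mu^\pm=\frac1{2\pi}dd^c(EG^\pm),$$ where $d^c=i(\bar\partial-\partial)$ and $\langle dd^cu,\varphi\rangle=\int_{\mathbb C^2}u\,dd^c\varphi$ for every test form $\varphi$, i.e. every smooth compactly supported $(1,1)$-form on $\mathbb C^2$. For an automorphism $F$ of $\mathbb C^2$ the pull-back of a current $T$ is given by $\langle F^*T,\varphi\rangle=\langle T,(F^{-1})^*\varphi\rangle$, and the integral of a family of currents is defined by integrating its values on each test form. Then, for each choice of the sign $\pm$, the limits and integrals above and below all exist, and: 1. $\mu^\pm=\int_X\mu_\Lambda^\pm\,d\overline m(\Lambda)$. 2. $(H_\lambda^{\pm1})^*\mu_\Lambda^\pm=d\,\mu_{\lambda\Lambda}^\pm$ for all $\lambda\in M$ and $\Lambda\in X$. 3. $\int_M EG^\pm\circ H_\lambda^{\pm1}(z)\,dm(\lambda)=d\,EG^\pm(z)$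 for all $z\in\mathbb C^2$. 4. $\int_M(H_\lambda^{\pm1})^*\mu^\pm\,dm(\lambda)=d\,\mu^\pm$. 5. $\operatorname{supp}\mu_\Lambda^\pm=J_\Lambda^\pm$ for every $\Lambda\in X$. 6. The set-valued map $\Lambda\mapsto J_\Lambda^\pm$ is lower semicontinuous: if an open set $U\subset\mathbb C^2$ meets $J^\pm_{\Lambda_0}$, then it meets $J_\Lambda^\pm$ for all $\Lambda$ in a neighbourhood of $\Lambda_0$. 7. If every nonempty relatively open subset of $M$ has positive $m$-measure, then $\operatorname{supp}\mu^\pm=\overline{\bigcup_{\Lambda\in X}J_\Lambda^\pm}$. -/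

import Mathlib

open MeasureTheory Filter Topology
open scoped ContDiff

/-! ### Forms and currents on `ℂ²` -/

/-- Complex-valued differential 2-forms on `ℂ²` (real-alternating in the tangent vectors). -/
abbrev TwoForm := ℂ × ℂ → (ℂ × ℂ) [⋀^Fin 2]→L[ℝ] ℂ

/-- The complex structure `v ↦ i v` of `ℂ²`, as a real-linear map. -/
noncomputable def mulI : (ℂ × ℂ) →L[ℝ] (ℂ × ℂ) :=
  Complex.I • ContinuousLinearMap.id ℝ (ℂ × ℂ)

/-- Test forms: smooth compactly supported 2-forms of bidegree `(1,1)`. Since `v ↦ i v` acts on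
forms of bidegree `(p,q)` as `i ^ (p - q)`, a 2-form has bidegree `(1,1)` iff it is invariant. -/
structure IsTestForm (φ : TwoForm) : Prop where
  smooth : ContDiff ℝ ∞ φ
  compact : HasCompactSupport φ
  bidegree : ∀ z, (φ z).compContinuousLinearMap mulI = φ z

/-- The operator `d^c = i (∂bar - ∂)` on forms `φ` of bidegree `(1,1)`: as `dφ = ∂φ + ∂bar φ` with
`∂φ` of bidegree `(2,1)` and `∂bar φ` of bidegree `(1,2)`, this is minus the form
`(u, v, w) ↦ dφ (i u, i v, i w)`. -/
noncomputable def dcForm (φ : TwoForm) : ℂ × ℂ → (ℂ × ℂ) [⋀^Fin 3]→L[ℝ] ℂ :=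
  fun z => -(extDeriv φ z).compContinuousLinearMap mulI

/-- The coefficient of the 4-form `dd^c φ` (that is `2 i ∂∂bar φ`) with respect to
`dx₁ ∧ dy₁ ∧ dx₂ ∧ dy₂`. -/
noncomputable def ddcCoeff (φ : TwoForm) (z : ℂ × ℂ) : ℂ :=
  extDeriv (dcForm φ) z ![(1, 0), (Complex.I, 0), (0, 1), (0, Complex.I)]

/-- The `(1,1)`-current `(1 / 2π) dd^c u` of a function `u`, as a functional on test forms:
`⟨(1 / 2π) dd^c u, φ⟩ = (1 / 2π) ∫ u dd^c φ`. -/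
noncomputable def ddcCurrent (u : ℂ × ℂ → ℝ) : TwoForm → ℂ :=
  fun φ => (1 / (2 * Real.pi) : ℝ) * ∫ z, (u z : ℂ) * ddcCoeff φ z

/-- The pull-back `F^* φ` of a 2-form. -/
noncomputable def pullbackForm (F : ℂ × ℂ → ℂ × ℂ) (φ : TwoForm) : TwoForm :=
  fun z => (φ (F z)).compContinuousLinearMap (fderiv ℝ F z)

/-- The pull-back `F^* T` of a current under an automorphism `F` of `ℂ²`:
`⟨F^* T, φ⟩ = ⟨T, (F⁻¹)^* φ⟩`. -/
noncomputable def pullbackCurrent (F : Equiv.Perm (ℂ × ℂ)) (T : TwoForm → ℂ) : TwoForm → ℂ :=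
  fun φ => T (pullbackForm (F⁻¹ : Equiv.Perm (ℂ × ℂ)) φ)

/-- The support of a current: `z` belongs to it iff `T` does not vanish on any open
neighbourhood of `z`. -/
def currentSupport (T : TwoForm → ℂ) : Set (ℂ × ℂ) :=
  {z | ∀ U : Set (ℂ × ℂ), IsOpen U → z ∈ U → ∃ φ, IsTestForm φ ∧ tsupport φ ⊆ U ∧ T φ ≠ 0}

/-! ### Families of Hénon maps -/

/-- The generalized Hénon map `(x, y) ↦ (y, p(y) - a x)` with `a ≠ 0`. -/
noncomputable def henonMap (p : Polynomial ℂ) (a : ℂ) (ha : a ≠ 0) : Equiv.Perm (ℂ × ℂ) where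
  toFun z := (z.2, p.eval z.2 - a * z.1)
  invFun w := ((p.eval w.1 - w.2) / a, w.1)
  left_inv z := by ext <;> simp [ha]
  right_inv w := by
    ext
    · simp
    · simp [mul_div_cancel₀ _ ha]

/-- The data of a continuous family `H_t`, `t ∈ M`, of compositions of `r ≥ 1` generalized Hénon
maps: the `j`-th factor of `H_t` is `(x, y) ↦ (y, p_{j,t}(y) - a_j(t) x)`, with `p_{j,t}` monic of
degree `d_j ≥ 2` independent of `t`, and with `a_j ≠ 0` and the coefficients of `p_{j,t}`
continuous in `t`. -/
structure HenonFamily (M : Type*) [TopologicalSpace M] where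
  r : ℕ
  r_pos : 1 ≤ r
  deg : Fin r → ℕ
  two_le_deg : ∀ j, 2 ≤ deg j
  p : Fin r → M → Polynomial ℂ
  monic : ∀ j t, (p j t).Monic
  natDegree_eq : ∀ j t, (p j t).natDegree = deg j
  continuous_coeff : ∀ j i, Continuous fun t => (p j t).coeff i
  a : Fin r → M → ℂ
  a_ne_zero : ∀ j t, a j t ≠ 0
  continuous_a : ∀ j, Continuous (a j)

/-- The sequence `tΛ = (t, λ₁, λ₂, …)` obtained from `Λ = (λ₁, λ₂, …)`. Sequences are indexed from
`0`, so that `λ_n` is `L (n - 1)`. -/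
def consSeq {M : Type*} (t : M) (L : ℕ → M) : ℕ → M
  | 0 => t
  | n + 1 => L n

namespace HenonFamily

variable {M : Type*} [TopologicalSpace M] (A : HenonFamily M)

/-- The degree `d = d₁ d₂ ⋯ d_r`. -/
def d : ℕ := ∏ j, A.deg j

/-- The map `H_t = H_t^(r) ∘ ⋯ ∘ H_t^(1)`; the product of permutations is composition. -/
noncomputable def H (t : M) : Equiv.Perm (ℂ × ℂ) :=
  (List.ofFn fun j => henonMap (A.p j t) (A.a j t) (A.a_ne_zero j t)).reverse.prod

/-- The random iterates `H_{λ_n}^{±1} ∘ ⋯ ∘ H_{λ_1}^{±1}`; the sign `±` is `ε = ±1`. -/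
noncomputable def iter (ε : ℤˣ) (L : ℕ → M) : ℕ → ℂ × ℂ → ℂ × ℂ
  | 0, z => z
  | n + 1, z => (A.H (L n) ^ (ε : ℤ)) (iter ε L n z)

/-- `G_{n,Λ}^±(z) = d^{-n} log⁺ ‖H_{n,Λ}^±(z)‖`, with the Euclidean norm of `ℂ²`. -/
noncomputable def greenApprox (ε : ℤˣ) (L : ℕ → M) (n : ℕ) (z : ℂ × ℂ) : ℝ :=
  1 / (A.d : ℝ) ^ n *
    Real.posLog (Real.sqrt (‖(A.iter ε L n z).1‖ ^ 2 + ‖(A.iter ε L n z).2‖ ^ 2))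

/-- The Green function `G_Λ^± = lim G_{n,Λ}^±`. -/
noncomputable def green (ε : ℤˣ) (L : ℕ → M) (z : ℂ × ℂ) : ℝ :=
  limUnder atTop fun n => A.greenApprox ε L n z

/-- The set `K_Λ^±` of points with bounded orbit. -/
def K (ε : ℤˣ) (L : ℕ → M) : Set (ℂ × ℂ) :=
  {z | Bornology.IsBounded (Set.range fun n => A.iter ε L n z)}

/-- `J_Λ^± = ∂K_Λ^±`. -/
def J (ε : ℤˣ) (L : ℕ → M) : Set (ℂ × ℂ) := frontier (A.K ε L)

/-- The random Green current `μ_Λ^± = (1 / 2π) dd^c G_Λ^±`. -/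
noncomputable def mu (ε : ℤˣ) (L : ℕ → M) : TwoForm → ℂ := ddcCurrent (A.green ε L)

variable [MeasurableSpace M]

/-- The average Green function `EG^±(z) = ∫_X G_Λ^±(z) dm̄(Λ)`, where `m̄ = m × m × ⋯`. -/
noncomputable def avgGreen (m : Measure M) [IsProbabilityMeasure m] (ε : ℤˣ) (z : ℂ × ℂ) : ℝ :=
  ∫ L, A.green ε L z ∂(Measure.infinitePi fun _ : ℕ => m)

/-- The average Green current `μ^± = (1 / 2π) dd^c EG^±`. -/
noncomputable def avgMu (m : Measure M) [IsProbabilityMeasure m] (ε : ℤˣ) : TwoForm → ℂ :=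
  ddcCurrent (A.avgGreen m ε)

end HenonFamily

/-! ### The operator `dd^c` in real coordinates -/

section Forms

/-! For either sign, all the maps of the compact family share one filtration: where one coordinate
`c` dominates and exceeds `R`, the region is forward invariant, `‖c‖` at least doubles, and `log
‖c‖` is multiplied by `d` up to a bounded error. A point outside this region either enters it or
does not grow (`HenonLike`, `exists_escapeSystem`). So `d^{-n} log max(‖F_n‖, R)` has geometrically
small increments, and its limit `G_Λ ≥ 0` is jointly continuous in `(Λ, z)` and vanishes exactly on
`K_Λ` (`abs_approx_succ_sub_le`, `continuous_G`, `mem_K_iff`). Shifting the index gives `G_Λ ∘ H_λ =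
d G_{λΛ}` (`G_comp_F`). The pull-back formulas and the averaged identities follow by change of
variables, Fubini, and invariance of the product measure under prepending an independent letter
(`pullbackCurrent_ddcCurrent`, `ddcCurrent_integral`, `map_consSeq_prod_infinitePi`).

For the supports, compact sets off `K_Λ` enter the escape region uniformly. There the approximants
are multiples of `log ‖f‖` with `f` entire and zero-free near the test form, so `dd^c G_Λ` vanishes
off `K_Λ` (`integral_log_norm_mul_ddcCoeff`, `ddcCurrent_G_eq_zero`); inside `K_Λ` the function is
zero. Conversely, if `dd^c u` vanishes on an open set and `u` is continuous, Weyl's lemma along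
horizontal and vertical lines yields mean value equalities (`meanEq_of_ddcCurrent_eq_zero`). A
nonnegative function with these equalities vanishes near each of its zeros, which is impossible for
`G_Λ` at a boundary point of `K_Λ` (`notMem_frontier_of_meanEq`).

The mean value equality also carries the last two claims. It is a closed condition in `Λ`, so sets
`J_Λ` that miss a ball cannot accumulate at a `Λ₀` with `J_{Λ₀}` meeting its centre. Each `G_Λ`
satisfies the mean value inequality (`G_le_circleAverage`), so equality for the average forces
equality for every `Λ` when the measure charges open sets (`MeanEq.of_integral`). -/

lemma mulI_apply (v : ℂ × ℂ) : mulI v = (Complex.I * v.1, Complex.I * v.2) := by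
  ext <;> simp [mulI]

/-- The derivative of `f` in the direction `v`. -/
noncomputable def dirDeriv (v : ℂ × ℂ) (f : ℂ × ℂ → ℂ) : ℂ × ℂ → ℂ := fun z => fderiv ℝ f z v

lemma ContDiff.dirDeriv {f : ℂ × ℂ → ℂ} (hf : ContDiff ℝ ∞ f) (v : ℂ × ℂ) :
    ContDiff ℝ ∞ (dirDeriv v f) :=
  (hf.fderiv_right (m := ∞) (by simp)).clm_apply contDiff_const

lemma tsupport_dirDeriv_subset (v : ℂ × ℂ) (f : ℂ × ℂ → ℂ) :
    tsupport (dirDeriv v f) ⊆ tsupport f := by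
  refine (closure_mono ?_).trans (tsupport_fderiv_subset ℝ (f := f))
  intro x hx h
  exact hx (by simp [dirDeriv, h])

lemma dirDeriv_neg (v : ℂ × ℂ) (f : ℂ × ℂ → ℂ) (z : ℂ × ℂ) :
    dirDeriv v (fun x => -f x) z = -dirDeriv v f z := by
  simp only [dirDeriv]; rw [fderiv_fun_neg]; rfl

lemma dirDeriv_neg_dir (v : ℂ × ℂ) (f : ℂ × ℂ → ℂ) (z : ℂ × ℂ) :
    dirDeriv (-v) f z = -dirDeriv v f z := by
  simp [dirDeriv]

lemma dirDeriv_add {f g : ℂ × ℂ → ℂ} (hf : ContDiff ℝ ∞ f) (hg : ContDiff ℝ ∞ g) (v : ℂ × ℂ) (z) :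
    dirDeriv v (fun x => f x + g x) z = dirDeriv v f z + dirDeriv v g z := by
  simp only [dirDeriv]
  rw [fderiv_fun_add (hf.differentiable (by simp) z) (hg.differentiable (by simp) z)]; rfl

lemma dirDeriv_sub {f g : ℂ × ℂ → ℂ} (hf : ContDiff ℝ ∞ f) (hg : ContDiff ℝ ∞ g) (v : ℂ × ℂ) (z) :
    dirDeriv v (fun x => f x - g x) z = dirDeriv v f z - dirDeriv v g z := by
  simp only [dirDeriv]
  rw [fderiv_fun_sub (hf.differentiable (by simp) z) (hg.differentiable (by simp) z)]; rfl

/-- The coefficient `φ(a, b)` of a 2-form. -/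
noncomputable def formCoeff (φ : TwoForm) (a b : ℂ × ℂ) : ℂ × ℂ → ℂ := fun z => φ z ![a, b]

lemma contDiff_formCoeff {φ : TwoForm} (hφ : ContDiff ℝ ∞ φ) (a b : ℂ × ℂ) :
    ContDiff ℝ ∞ (formCoeff φ a b) :=
  (ContinuousAlternatingMap.apply ℝ (ℂ × ℂ) ℂ ![a, b]).contDiff.comp hφ

lemma tsupport_formCoeff_subset (φ : TwoForm) (a b : ℂ × ℂ) :
    tsupport (formCoeff φ a b) ⊆ tsupport φ := by
  refine closure_mono ?_
  intro x hx h
  exact hx (by simp [formCoeff, h])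

lemma contDiff_extDeriv {n : ℕ} {φ : ℂ × ℂ → (ℂ × ℂ) [⋀^Fin n]→L[ℝ] ℂ} (hφ : ContDiff ℝ ∞ φ) :
    ContDiff ℝ ∞ (extDeriv φ) := by
  have h : ContDiff ℝ ∞ (fderiv ℝ φ) := hφ.fderiv_right (by simp)
  exact (ContinuousLinearMap.contDiff
    (ContinuousAlternatingMap.alternatizeUncurryFinCLM ℝ (ℂ × ℂ) ℂ (n := n))).comp h

lemma contDiff_dcForm {φ : TwoForm} (hφ : ContDiff ℝ ∞ φ) : ContDiff ℝ ∞ (dcForm φ) :=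
  ((ContinuousAlternatingMap.compContinuousLinearMapCLM mulI).contDiff.comp
    (contDiff_extDeriv hφ)).neg

/-- Invariance of `φ` under `mulI` absorbs the rotation of the two arguments fed to `φ`, so only the
direction of differentiation stays rotated. -/
lemma dcForm_apply {φ : TwoForm} (hφ : ContDiff ℝ ∞ φ)
    (hJ : ∀ z, (φ z).compContinuousLinearMap mulI = φ z) (a b c z : ℂ × ℂ) :
    dcForm φ z ![a, b, c] = -(dirDeriv (mulI a) (formCoeff φ b c) z
      - dirDeriv (mulI b) (formCoeff φ a c) z + dirDeriv (mulI c) (formCoeff φ a b) z) := by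
  have hJ' : ∀ u v w, φ w ![mulI u, mulI v] = φ w ![u, v] := by
    intro u v w
    conv_rhs => rw [← hJ w]
    rw [ContinuousAlternatingMap.compContinuousLinearMap_apply]
    congr 1; funext i; fin_cases i <;> rfl
  have h0 : (mulI ∘ ![a, b, c] : Fin 3 → ℂ × ℂ) = ![mulI a, mulI b, mulI c] := by
    funext i; fin_cases i <;> rfl
  have h1 : ∀ u v w : ℂ × ℂ, Fin.removeNth (0 : Fin 3) ![u, v, w] = ![v, w] := by
    intro u v w; funext i; fin_cases i <;> rfl
  have h2 : ∀ u v w : ℂ × ℂ, Fin.removeNth (1 : Fin 3) ![u, v, w] = ![u, w] := by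
    intro u v w; funext i; fin_cases i <;> rfl
  have h3 : ∀ u v w : ℂ × ℂ, Fin.removeNth (2 : Fin 3) ![u, v, w] = ![u, v] := by
    intro u v w; funext i; fin_cases i <;> rfl
  rw [dcForm, ContinuousAlternatingMap.neg_apply,
    ContinuousAlternatingMap.compContinuousLinearMap_apply, h0,
    extDeriv_apply (hφ.differentiable (by simp) z), Fin.sum_univ_three, h1, h2, h3]
  simp only [hJ', dirDeriv]
  simp
  rw [sub_eq_add_neg]
  rfl

/-- The operator `dd^c` on `(1,1)`-forms in coordinates. -/
lemma ddcCoeff_eq {φ : TwoForm} (hφ : ContDiff ℝ ∞ φ)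
    (hJ : ∀ z, (φ z).compContinuousLinearMap mulI = φ z) (z : ℂ × ℂ) :
    ddcCoeff φ z =
      (dirDeriv (1, 0) (dirDeriv (1, 0) (formCoeff φ (0, 1) (0, Complex.I))) z
        + dirDeriv (Complex.I, 0) (dirDeriv (Complex.I, 0) (formCoeff φ (0, 1) (0, Complex.I))) z)
      + (dirDeriv (0, 1) (dirDeriv (0, 1) (formCoeff φ (1, 0) (Complex.I, 0))) z
        + dirDeriv (0, Complex.I) (dirDeriv (0, Complex.I) (formCoeff φ (1, 0) (Complex.I, 0))) z)
      + (dirDeriv (1, 0) (dirDeriv (0, Complex.I) (formCoeff φ (1, 0) (0, 1))) z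
        - dirDeriv (Complex.I, 0) (dirDeriv (0, 1) (formCoeff φ (1, 0) (0, 1))) z
        + (dirDeriv (0, Complex.I) (dirDeriv (1, 0) (formCoeff φ (1, 0) (0, 1))) z
        - dirDeriv (0, 1) (dirDeriv (Complex.I, 0) (formCoeff φ (1, 0) (0, 1))) z))
      + (dirDeriv (1, 0) (dirDeriv (0, 1) (formCoeff φ (Complex.I, 0) (0, 1))) z
        + dirDeriv (Complex.I, 0) (dirDeriv (0, Complex.I) (formCoeff φ (Complex.I, 0) (0, 1))) z
        + (dirDeriv (0, 1) (dirDeriv (1, 0) (formCoeff φ (Complex.I, 0) (0, 1))) z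
        + dirDeriv (0, Complex.I) (dirDeriv (Complex.I, 0)
          (formCoeff φ (Complex.I, 0) (0, 1))) z)) := by
  have j1 : mulI (1, 0) = (Complex.I, 0) := by simp [mulI_apply]
  have j2 : mulI (Complex.I, 0) = -(1, 0) := by simp [mulI_apply]
  have j3 : mulI (0, 1) = (0, Complex.I) := by simp [mulI_apply]
  have j4 : mulI (0, Complex.I) = -(0, 1) := by simp [mulI_apply]
  have hJ' : ∀ u v w, φ w ![u, v] = φ w ![mulI u, mulI v] := by
    intro u v w
    conv_lhs => rw [← hJ w]
    rw [ContinuousAlternatingMap.compContinuousLinearMap_apply]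
    congr 1; funext i; fin_cases i <;> rfl
  -- Bidegree `(1,1)` leaves four independent coefficients out of six. The mixed second derivatives
  -- are kept in both orders, so no symmetry of second derivatives is needed.
  have c24 : formCoeff φ (Complex.I, 0) (0, Complex.I) = formCoeff φ (1, 0) (0, 1) := by
    ext w; simp only [formCoeff]; rw [hJ' (1, 0), j1, j3]
  have c14 : formCoeff φ (1, 0) (0, Complex.I) =
      fun w => -formCoeff φ (Complex.I, 0) (0, 1) w := by
    ext w; simp only [formCoeff]; rw [hJ' (1, 0), j1, j4]
    have := (φ w).map_update_neg ![(Complex.I, 0), (0, 1)] 1 (0, 1)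
    have e1 : ∀ x : ℂ × ℂ, Function.update ![(Complex.I, 0), (0, 1)] 1 x = ![(Complex.I, 0), x] := by
      intro x; funext i; fin_cases i <;> rfl
    rwa [e1, e1] at this
  set e1 : ℂ × ℂ := (1, 0)
  set e2 : ℂ × ℂ := (Complex.I, 0)
  set e3 : ℂ × ℂ := (0, 1)
  set e4 : ℂ × ℂ := (0, Complex.I)
  have h1 : ∀ t u v w : ℂ × ℂ, Fin.removeNth (0 : Fin 4) ![t, u, v, w] = ![u, v, w] := by
    intro t u v w; funext i; fin_cases i <;> rfl
  have h2 : ∀ t u v w : ℂ × ℂ, Fin.removeNth (1 : Fin 4) ![t, u, v, w] = ![t, v, w] := by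
    intro t u v w; funext i; fin_cases i <;> rfl
  have h3 : ∀ t u v w : ℂ × ℂ, Fin.removeNth (2 : Fin 4) ![t, u, v, w] = ![t, u, w] := by
    intro t u v w; funext i; fin_cases i <;> rfl
  have h4 : ∀ t u v w : ℂ × ℂ, Fin.removeNth (3 : Fin 4) ![t, u, v, w] = ![t, u, v] := by
    intro t u v w; funext i; fin_cases i <;> rfl
  have key : ddcCoeff φ z = dirDeriv e1 (fun w => dcForm φ w ![e2, e3, e4]) z
      - dirDeriv e2 (fun w => dcForm φ w ![e1, e3, e4]) z
      + dirDeriv e3 (fun w => dcForm φ w ![e1, e2, e4]) z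
      - dirDeriv e4 (fun w => dcForm φ w ![e1, e2, e3]) z := by
    rw [ddcCoeff, extDeriv_apply ((contDiff_dcForm hφ).differentiable (by simp) z),
      Fin.sum_univ_four, h1, h2, h3, h4]
    simp only [dirDeriv]
    simp [pow_succ, sub_eq_add_neg]
    rfl
  have S := fun a b u => (contDiff_formCoeff hφ a b).dirDeriv u
  have k1 : (fun w => dcForm φ w ![e2, e3, e4]) = fun w => dirDeriv e1 (formCoeff φ e3 e4) w
      + dirDeriv e4 (formCoeff φ e1 e3) w + dirDeriv e3 (formCoeff φ e2 e3) w := by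
    funext w
    simp only [dcForm_apply hφ hJ, j2, j3, j4, dirDeriv_neg_dir, c24]
    ring
  have k2 : (fun w => dcForm φ w ![e1, e3, e4]) = fun w => dirDeriv e3 (formCoeff φ e1 e3) w
      - dirDeriv e4 (formCoeff φ e2 e3) w - dirDeriv e2 (formCoeff φ e3 e4) w := by
    funext w
    simp only [dcForm_apply hφ hJ, j1, j3, j4, dirDeriv_neg, dirDeriv_neg_dir, c14]
    ring
  have k3 : (fun w => dcForm φ w ![e1, e2, e4]) = fun w => dirDeriv e1 (formCoeff φ e2 e3) w
      - dirDeriv e2 (formCoeff φ e1 e3) w + dirDeriv e3 (formCoeff φ e1 e2) w := by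
    funext w
    simp only [dcForm_apply hφ hJ, j1, j2, j4, dirDeriv_neg, dirDeriv_neg_dir, c24, c14]
    ring
  have k4 : (fun w => dcForm φ w ![e1, e2, e3]) = fun w => -(dirDeriv e2 (formCoeff φ e2 e3) w
      + dirDeriv e1 (formCoeff φ e1 e3) w + dirDeriv e4 (formCoeff φ e1 e2) w) := by
    funext w
    simp only [dcForm_apply hφ hJ, j1, j2, j3, dirDeriv_neg_dir]
    ring
  rw [key, k1, k2, k3, k4, dirDeriv_neg,
    dirDeriv_add ((S _ _ _).add (S _ _ _)) (S _ _ _), dirDeriv_add (S _ _ _) (S _ _ _),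
    dirDeriv_sub ((S _ _ _).sub (S _ _ _)) (S _ _ _), dirDeriv_sub (S _ _ _) (S _ _ _),
    dirDeriv_add ((S _ _ _).sub (S _ _ _)) (S _ _ _), dirDeriv_sub (S _ _ _) (S _ _ _),
    dirDeriv_add ((S _ _ _).add (S _ _ _)) (S _ _ _), dirDeriv_add (S _ _ _) (S _ _ _)]
  ring

lemma tsupport_ddcCoeff_subset {φ : TwoForm} : tsupport (ddcCoeff φ) ⊆ tsupport φ := by
  have h1 : ∀ {n : ℕ} (η : ℂ × ℂ → (ℂ × ℂ) [⋀^Fin n]→L[ℝ] ℂ), tsupport (extDeriv η) ⊆ tsupport η := by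
    intro n η
    refine (closure_mono ?_).trans (tsupport_fderiv_subset ℝ (f := η))
    intro x hx h
    refine hx ?_
    rw [extDeriv, h]
    exact map_zero (ContinuousAlternatingMap.alternatizeUncurryFinCLM ℝ (ℂ × ℂ) ℂ)
  refine Set.Subset.trans (closure_mono ?_) ((h1 (dcForm φ)).trans
    (Set.Subset.trans (closure_mono ?_) (h1 φ)))
  · intro x hx h
    exact hx (by simp [ddcCoeff, h])
  · intro x hx h
    refine hx ?_
    simp only [dcForm, h]
    ext v
    simp

lemma continuous_ddcCoeff {φ : TwoForm} (hφ : ContDiff ℝ ∞ φ) : Continuous (ddcCoeff φ) :=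
  ((ContinuousAlternatingMap.apply ℝ (ℂ × ℂ) ℂ _).continuous.comp
    (contDiff_extDeriv (contDiff_dcForm hφ)).continuous)

lemma IsTestForm.hasCompactSupport_ddcCoeff {φ : TwoForm} (hφ : IsTestForm φ) :
    HasCompactSupport (ddcCoeff φ) :=
  hφ.compact.of_isClosed_subset (isClosed_tsupport _) tsupport_ddcCoeff_subset

end Forms

/-! ### Pluriharmonicity of `log ‖f‖` -/

instance : (volume : Measure (ℂ × ℂ)).IsAddHaarMeasure :=
  inferInstanceAs ((volume : Measure ℂ).prod volume).IsAddHaarMeasure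

section LogHolomorphic

/-- Continuity of `g` is required only on `tsupport ψ`, because the intended `g = log ‖f‖` is
singular at the zeros of `f`. -/
lemma integrable_mul_of_continuousAt_tsupport {g ψ : ℂ × ℂ → ℂ}
    (hg : ∀ z ∈ tsupport ψ, ContinuousAt g z) (hψ : Continuous ψ) (hc : HasCompactSupport ψ) :
    Integrable (fun z => g z * ψ z) := by
  rw [← integrableOn_iff_integrable_of_support_subset (s := tsupport ψ)]
  · exact ContinuousOn.integrableOn_compact hc
      (ContinuousOn.mul (fun z hz => (hg z hz).continuousWithinAt) hψ.continuousOn)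
  · intro z hz
    exact subset_tsupport _ (right_ne_zero_of_mul hz)

lemma integral_mul_dirDeriv {g ψ : ℂ × ℂ → ℂ} (v : ℂ × ℂ)
    (hg : ∀ z ∈ tsupport ψ, ContDiffAt ℝ 1 g z) (hψ : ContDiff ℝ ∞ ψ) (hc : HasCompactSupport ψ) :
    ∫ z, g z * dirDeriv v ψ z = - ∫ z, dirDeriv v g z * ψ z := by
  have hsub := tsupport_dirDeriv_subset v ψ
  apply integral_mul_fderiv_eq_neg_fderiv_mul_of_integrable
  · refine integrable_mul_of_continuousAt_tsupport (fun z hz => ?_) hψ.continuous hc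
    exact ((hg z hz).fderiv_right (m := 0) (by simp)).continuousAt.clm_apply continuousAt_const
  · exact integrable_mul_of_continuousAt_tsupport (fun z hz => (hg z (hsub hz)).continuousAt)
      (hψ.dirDeriv v).continuous (hc.of_isClosed_subset (isClosed_tsupport _) hsub)
  · exact integrable_mul_of_continuousAt_tsupport (fun z hz => (hg z hz).continuousAt)
      hψ.continuous hc
  · exact fun z hz => (hg z hz).differentiableAt (by simp)
  · exact fun z _ => hψ.differentiable (by simp) z

lemma integral_mul_dirDeriv_dirDeriv {g ψ : ℂ × ℂ → ℂ} (a b : ℂ × ℂ)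
    (hg : ∀ z ∈ tsupport ψ, ContDiffAt ℝ 2 g z) (hψ : ContDiff ℝ ∞ ψ) (hc : HasCompactSupport ψ) :
    ∫ z, g z * dirDeriv a (dirDeriv b ψ) z = ∫ z, dirDeriv b (dirDeriv a g) z * ψ z := by
  have hsub := tsupport_dirDeriv_subset b ψ
  rw [integral_mul_dirDeriv a (fun z hz => (hg z (hsub hz)).of_le (by norm_num)) (hψ.dirDeriv b)
    (hc.of_isClosed_subset (isClosed_tsupport _) hsub),
    integral_mul_dirDeriv b (fun z hz => ?_) hψ hc, neg_neg]
  exact ((hg z hz).fderiv_right (m := 1) (by norm_num)).clm_apply contDiffAt_const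

/-- The logarithmic derivative of `f` in the direction `v`. -/
noncomputable def logDir (f : ℂ × ℂ → ℂ) (v : ℂ × ℂ) : ℂ × ℂ → ℂ := fun z => fderiv ℂ f z v / f z

/-- Near `z` the quotient `f w / f z` is close to `1`, so its principal logarithm is holomorphic
whatever the argument of `f z`; `log ‖f‖` is the real part of this logarithm plus a constant. -/
lemma hasFDerivAt_log_norm {f : ℂ × ℂ → ℂ} (hf : ContDiff ℂ ∞ f) {z : ℂ × ℂ} (hz : f z ≠ 0) :
    HasFDerivAt (fun w => ((Real.log ‖f w‖ : ℝ) : ℂ))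
      (Complex.ofRealCLM.comp (Complex.reCLM.comp
        (((f z)⁻¹ • fderiv ℂ f z).restrictScalars ℝ))) z := by
  have h1 : HasFDerivAt (fun w => Complex.log (f w / f z)) ((f z)⁻¹ • fderiv ℂ f z) z := by
    have := (((hf.differentiable (by simp) z).hasFDerivAt).mul_const (f z)⁻¹).clog (by simp [hz])
    simpa [div_eq_mul_inv, hz] using this
  have h2 := (Complex.reCLM.hasFDerivAt.comp z (h1.restrictScalars ℝ)).add_const (Real.log ‖f z‖)
  have h3 := Complex.ofRealCLM.hasFDerivAt.comp z h2
  refine h3.congr_of_eventuallyEq ?_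
  filter_upwards [hf.continuous.continuousAt.eventually_ne hz] with w hw
  simp [Complex.log_re, Real.log_div (norm_ne_zero_iff.2 hw) (norm_ne_zero_iff.2 hz)]

lemma contDiffAt_log_norm {f : ℂ × ℂ → ℂ} (hf : ContDiff ℂ ∞ f) {z : ℂ × ℂ} (hz : f z ≠ 0) :
    ContDiffAt ℝ 2 (fun w => ((Real.log ‖f w‖ : ℝ) : ℂ)) z := by
  have hf' : ContDiff ℝ 2 f := (contDiff_infty.1 hf 2).restrict_scalars ℝ
  exact Complex.ofRealCLM.contDiff.contDiffAt.comp z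
    ((hf'.contDiffAt.norm ℂ hz).log (norm_ne_zero_iff.2 hz))

lemma dirDeriv_dirDeriv_log_norm {f : ℂ × ℂ → ℂ} (hf : ContDiff ℂ ∞ f) {z : ℂ × ℂ}
    (hz : f z ≠ 0) (a b : ℂ × ℂ) :
    dirDeriv b (dirDeriv a (fun w => ((Real.log ‖f w‖ : ℝ) : ℂ))) z =
      ((fderiv ℂ (logDir f a) z b).re : ℂ) := by
  have h1 : dirDeriv a (fun w => ((Real.log ‖f w‖ : ℝ) : ℂ)) =ᶠ[𝓝 z]
      fun w => (((logDir f a w).re : ℝ) : ℂ) := by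
    filter_upwards [hf.continuous.continuousAt.eventually_ne hz] with w hw
    rw [dirDeriv, (hasFDerivAt_log_norm hf hw).fderiv]
    simp [logDir, div_eq_inv_mul]
  have h2 : DifferentiableAt ℂ (logDir f a) z := by
    have : ContDiff ℂ 1 (fun w => fderiv ℂ f w a) :=
      ((contDiff_infty.1 hf 2).fderiv_right (m := 1) (by norm_num)).clm_apply contDiff_const
    have h1 := this.differentiable (by simp) z
    have h2 := hf.differentiable (by simp) z
    unfold logDir
    fun_prop (disch := assumption)
  have h3 := Complex.ofRealCLM.hasFDerivAt.comp z
    (Complex.reCLM.hasFDerivAt.comp z (h2.hasFDerivAt.restrictScalars ℝ))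
  rw [dirDeriv, h1.fderiv_eq, show (fun w => (((logDir f a w).re : ℝ) : ℂ)) =
    (Complex.ofRealCLM ∘ Complex.reCLM ∘ logDir f a) from rfl, h3.fderiv]
  simp

lemma logDir_I_smul (f : ℂ × ℂ → ℂ) (v : ℂ × ℂ) :
    logDir f (Complex.I • v) = Complex.I • logDir f v := by
  funext z; simp [logDir, mul_div_assoc]

/-- `log ‖f‖` is pluriharmonic in the sense of currents where the entire function `f` has no
zeros. -/
lemma integral_log_norm_mul_ddcCoeff {f : ℂ × ℂ → ℂ} (hf : ContDiff ℂ ∞ f) {φ : TwoForm}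
    (hφ : IsTestForm φ) (h0 : ∀ z ∈ tsupport φ, f z ≠ 0) :
    ∫ z, ((Real.log ‖f z‖ : ℝ) : ℂ) * ddcCoeff φ z = 0 := by
  set u : ℂ × ℂ → ℂ := fun z => ((Real.log ‖f z‖ : ℝ) : ℂ) with hu
  have hc : ∀ a b, HasCompactSupport (formCoeff φ a b) := fun a b =>
    hφ.compact.of_isClosed_subset (isClosed_tsupport _) (tsupport_formCoeff_subset φ a b)
  have hs : ∀ a b, ContDiff ℝ ∞ (formCoeff φ a b) := contDiff_formCoeff hφ.smooth
  have hsub := tsupport_formCoeff_subset φ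
  have hint : ∀ a b s t, Integrable (fun z => u z * dirDeriv s (dirDeriv t (formCoeff φ a b)) z) := by
    intro a b s t
    have hsub' := (tsupport_dirDeriv_subset s (dirDeriv t (formCoeff φ a b))).trans
      (tsupport_dirDeriv_subset t (formCoeff φ a b))
    exact integrable_mul_of_continuousAt_tsupport
      (fun z hz => (contDiffAt_log_norm hf (h0 z (hsub a b (hsub' hz)))).continuousAt)
      (((hs a b).dirDeriv t).dirDeriv s).continuous
      ((hc a b).of_isClosed_subset (isClosed_tsupport _) hsub')
  have hparts : ∀ a b s t, ∫ z, u z * dirDeriv s (dirDeriv t (formCoeff φ a b)) z =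
      ∫ z, ((fderiv ℂ (logDir f s) z t).re : ℂ) * formCoeff φ a b z := by
    intro a b s t
    rw [integral_mul_dirDeriv_dirDeriv s t
      (fun z hz => contDiffAt_log_norm hf (h0 z (hsub a b hz))) (hs a b) (hc a b)]
    refine integral_congr_ae (ae_of_all _ fun z => ?_)
    by_cases hz : z ∈ tsupport φ
    · simp only; rw [dirDeriv_dirDeriv_log_norm hf (h0 z hz)]
    · have : formCoeff φ a b z = 0 := image_eq_zero_of_notMem_tsupport fun h => hz (hsub a b h)
      simp [this]
  -- Rotating both directions multiplies the second derivative by `I ^ 2 = -1`. Together with `hI2`,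
  -- which moves a rotation from one direction to the other, this cancels all the terms of
  -- `ddcCoeff_eq` in pairs.
  have hI : ∀ a b s t, (∫ z, ((fderiv ℂ (logDir f (Complex.I • s)) z (Complex.I • t)).re : ℂ)
      * formCoeff φ a b z) = -∫ z, ((fderiv ℂ (logDir f s) z t).re : ℂ) * formCoeff φ a b z := by
    intro a b s t
    rw [← integral_neg]
    refine integral_congr_ae (ae_of_all _ fun z => ?_)
    simp only
    rw [logDir_I_smul, fderiv_const_smul_field]
    simp
  have hI2 : ∀ a b s t, (∫ z, ((fderiv ℂ (logDir f (Complex.I • s)) z t).re : ℂ)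
      * formCoeff φ a b z) = ∫ z, ((fderiv ℂ (logDir f s) z (Complex.I • t)).re : ℂ)
        * formCoeff φ a b z := by
    intro a b s t
    refine integral_congr_ae (ae_of_all _ fun z => ?_)
    simp only
    rw [logDir_I_smul, fderiv_const_smul_field]
    simp
  have i2 : ((Complex.I, 0) : ℂ × ℂ) = Complex.I • (1, 0) := by simp
  have i4 : ((0, Complex.I) : ℂ × ℂ) = Complex.I • (0, 1) := by simp
  have A : ∀ {f g : ℂ × ℂ → ℂ}, Integrable f → Integrable g → Integrable (fun z => f z + g z) :=
    fun hf hg => hf.add hg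
  have S : ∀ {f g : ℂ × ℂ → ℂ}, Integrable f → Integrable g → Integrable (fun z => f z - g z) :=
    fun hf hg => hf.sub hg
  have g1 := fun a b s t s' t' => A (hint a b s t) (hint a b s' t')
  have g2 := fun a b s t s' t' => S (hint a b s t) (hint a b s' t')
  simp only [ddcCoeff_eq hφ.smooth hφ.bidegree, mul_add, mul_sub]
  rw [integral_add (A (A (g1 _ _ _ _ _ _) (g1 _ _ _ _ _ _))
      (A (g2 _ _ _ _ _ _) (g2 _ _ _ _ _ _))) (A (g1 _ _ _ _ _ _) (g1 _ _ _ _ _ _)),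
    integral_add (A (g1 _ _ _ _ _ _) (g1 _ _ _ _ _ _))
      (A (g2 _ _ _ _ _ _) (g2 _ _ _ _ _ _)),
    integral_add (g1 _ _ _ _ _ _) (g1 _ _ _ _ _ _),
    integral_add (g2 _ _ _ _ _ _) (g2 _ _ _ _ _ _),
    integral_add (g1 _ _ _ _ _ _) (g1 _ _ _ _ _ _),
    integral_add (hint _ _ _ _) (hint _ _ _ _), integral_add (hint _ _ _ _) (hint _ _ _ _),
    integral_sub (hint _ _ _ _) (hint _ _ _ _), integral_sub (hint _ _ _ _) (hint _ _ _ _),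
    integral_add (hint _ _ _ _) (hint _ _ _ _), integral_add (hint _ _ _ _) (hint _ _ _ _)]
  simp only [hparts, i2, i4, hI, hI2]
  ring

end LogHolomorphic

/-! ### Pull-back of `dd^c` under automorphisms -/

section Pullback

/-- The real basis `(1, 0), (i, 0), (0, 1), (0, i)` of `ℂ²`. -/
noncomputable def realBasis : Module.Basis (Fin 4) ℝ (ℂ × ℂ) :=
  (Complex.basisOneI.prod Complex.basisOneI).reindex finSumFinEquiv

lemma coe_realBasis : ⇑realBasis = ![(1, 0), (Complex.I, 0), (0, 1), (0, Complex.I)] := by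
  have h0 : (finSumFinEquiv (m := 2) (n := 2)).symm 0 = Sum.inl 0 := rfl
  have h1 : (finSumFinEquiv (m := 2) (n := 2)).symm 1 = Sum.inl 1 := rfl
  have h2 : (finSumFinEquiv (m := 2) (n := 2)).symm 2 = Sum.inr 0 := rfl
  have h3 : (finSumFinEquiv (m := 2) (n := 2)).symm 3 = Sum.inr 1 := rfl
  funext i
  rw [realBasis, Module.Basis.reindex_apply]
  match i with
  | 0 => rw [h0, Module.Basis.prod_apply]; simp
  | 1 => rw [h1, Module.Basis.prod_apply]; simp
  | 2 => rw [h2, Module.Basis.prod_apply]; simp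
  | 3 => rw [h3, Module.Basis.prod_apply]; simp

lemma alternating_map_comp_basis {ι E : Type*} [Fintype ι] [DecidableEq ι] [AddCommGroup E]
    [Module ℝ E] (e : Module.Basis ι ℝ E) (g : E [⋀^ι]→ₗ[ℝ] ℝ) (T : E →ₗ[ℝ] E) :
    g (T ∘ e) = LinearMap.det T * g e := by
  rw [g.eq_smul_basis_det e]
  simp [Module.Basis.det_comp, Module.Basis.det_self, mul_comm]

/-- Top-degree real forms scale by the determinant; a complex-valued form is split into its real and
imaginary parts. -/
lemma alternating_apply_comp_realBasis (η : (ℂ × ℂ) [⋀^Fin 4]→L[ℝ] ℂ)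
    (T : (ℂ × ℂ) →L[ℝ] (ℂ × ℂ)) : η (T ∘ realBasis) = (T.det : ℂ) * η realBasis := by
  have h1 := alternating_map_comp_basis realBasis
    (Complex.reLm.compAlternatingMap η.toAlternatingMap) T.toLinearMap
  have h2 := alternating_map_comp_basis realBasis
    (Complex.imLm.compAlternatingMap η.toAlternatingMap) T.toLinearMap
  apply Complex.ext
  · simpa using! h1
  · simpa using! h2

lemma fderiv_real_eq {F : ℂ × ℂ → ℂ × ℂ} (hF : ContDiff ℂ ∞ F) (z : ℂ × ℂ) :
    fderiv ℝ F z = (fderiv ℂ F z).restrictScalars ℝ :=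
  (hF.differentiable (by simp) z).fderiv_restrictScalars ℝ

/-- The real determinant of a complex-linear map is the squared modulus of its complex determinant.
This removes the absolute value from the change of variables formula. -/
lemma det_fderiv_real_nonneg {F : ℂ × ℂ → ℂ × ℂ} (hF : ContDiff ℂ ∞ F) (z : ℂ × ℂ) :
    0 ≤ (fderiv ℝ F z).det := by
  rw [fderiv_real_eq hF]
  have : ((fderiv ℂ F z).restrictScalars ℝ).det =
      LinearMap.det ((fderiv ℂ F z).toLinearMap.restrictScalars ℝ) := rfl
  rw [this, LinearMap.det_restrictScalars, Algebra.norm_complex_apply]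
  exact Complex.normSq_nonneg _

lemma extDeriv_pullback_of_contDiff {n : ℕ} {F : ℂ × ℂ → ℂ × ℂ} (hF : ContDiff ℂ ∞ F)
    {η : ℂ × ℂ → (ℂ × ℂ) [⋀^Fin n]→L[ℝ] ℂ} (hη : ContDiff ℝ ∞ η) (z : ℂ × ℂ) :
    extDeriv (fun w => (η (F w)).compContinuousLinearMap (fderiv ℝ F w)) z =
      (extDeriv η (F z)).compContinuousLinearMap (fderiv ℝ F z) :=
  extDeriv_pullback (r := 2) (hη.differentiable (by simp) _)
    (contDiff_infty.1 (hF.restrict_scalars ℝ) 2).contDiffAt (by simp)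

/-- The derivative of a holomorphic map commutes with `mulI`, so pull-back commutes with `d^c` as it
does with `d`. -/
lemma dcForm_pullbackForm {F : ℂ × ℂ → ℂ × ℂ} (hF : ContDiff ℂ ∞ F) {φ : TwoForm}
    (hφ : ContDiff ℝ ∞ φ) :
    dcForm (pullbackForm F φ) =
      fun z => (dcForm φ (F z)).compContinuousLinearMap (fderiv ℝ F z) := by
  funext z
  simp only [dcForm]
  rw [show pullbackForm F φ = fun w => (φ (F w)).compContinuousLinearMap (fderiv ℝ F w) from rfl,
    extDeriv_pullback_of_contDiff hF hφ]
  ext v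
  simp only [ContinuousAlternatingMap.neg_apply,
    ContinuousAlternatingMap.compContinuousLinearMap_apply]
  congr 2
  funext i
  rw [fderiv_real_eq hF]
  simp only [Function.comp_apply, mulI, FunLike.coe_smul, Pi.smul_apply,
    ContinuousLinearMap.id_apply, ContinuousLinearMap.coe_restrictScalars', map_smul]

lemma ddcCoeff_pullbackForm {F : ℂ × ℂ → ℂ × ℂ} (hF : ContDiff ℂ ∞ F) {φ : TwoForm}
    (hφ : ContDiff ℝ ∞ φ) (z : ℂ × ℂ) :
    ddcCoeff (pullbackForm F φ) z = ((fderiv ℝ F z).det : ℂ) * ddcCoeff φ (F z) := by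
  simp only [ddcCoeff]
  rw [dcForm_pullbackForm hF hφ, extDeriv_pullback_of_contDiff hF (contDiff_dcForm hφ),
    ← coe_realBasis, ContinuousAlternatingMap.compContinuousLinearMap_apply,
    alternating_apply_comp_realBasis]

/-- Substituting `F⁻¹` in the integral produces exactly the Jacobian factor by which `dd^c` of the
pulled-back form differs from `dd^c φ` composed with `F⁻¹`. -/
lemma pullbackCurrent_ddcCurrent {F : Equiv.Perm (ℂ × ℂ)}
    (hF' : ContDiff ℂ ∞ ⇑(F⁻¹ : Equiv.Perm (ℂ × ℂ))) (u : ℂ × ℂ → ℝ) {φ : TwoForm}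
    (hφ : ContDiff ℝ ∞ φ) :
    pullbackCurrent F (ddcCurrent u) φ = ddcCurrent (fun z => u (F z)) φ := by
  set G : ℂ × ℂ → ℂ × ℂ := ⇑(F⁻¹ : Equiv.Perm (ℂ × ℂ)) with hG
  have hFG : ∀ z, F (G z) = z := fun z => Equiv.apply_symm_apply F z
  simp only [pullbackCurrent, ddcCurrent]
  congr 1
  have h := integral_image_eq_integral_abs_det_fderiv_smul (volume : Measure (ℂ × ℂ))
    (f := G) (f' := fun z => fderiv ℝ G z) MeasurableSet.univ
    (fun z _ => (((hF'.restrict_scalars ℝ).differentiable (by simp)) z).hasFDerivAt.hasFDerivWithinAt)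
    (F⁻¹ : Equiv.Perm (ℂ × ℂ)).injective.injOn (fun w => (u (F w) : ℂ) * ddcCoeff φ w)
  rw [Set.image_univ, (F⁻¹ : Equiv.Perm (ℂ × ℂ)).surjective.range_eq, Measure.restrict_univ] at h
  rw [h]
  refine integral_congr_ae (ae_of_all _ fun z => ?_)
  simp only
  rw [ddcCoeff_pullbackForm hF' hφ, abs_of_nonneg (det_fderiv_real_nonneg hF' z), hFG,
    Complex.real_smul]
  ring

end Pullback

/-! ### Weyl's lemma along complex lines -/

section Weyl

/-- `u` satisfies the mean value equality on all discs in direction `v` contained in `U`. -/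
def MeanEq (v : ℂ × ℂ) (u : ℂ × ℂ → ℝ) (U : Set (ℂ × ℂ)) : Prop :=
  ∀ z : ℂ × ℂ, ∀ r : ℝ, 0 < r → (∀ w ∈ Metric.closedBall (0 : ℂ) r, z + w • v ∈ U) →
    Real.circleAverage (fun w => u (z + w • v)) 0 r = u z

open scoped Convolution

/-- Convolution of complex-valued functions on `ℂ²`. -/
noncomputable def conv (g ψ : ℂ × ℂ → ℂ) : ℂ × ℂ → ℂ :=
  g ⋆[ContinuousLinearMap.mul ℝ ℂ, volume] ψ

lemma conv_apply (g ψ : ℂ × ℂ → ℂ) (x : ℂ × ℂ) : conv g ψ x = ∫ t, g t * ψ (x - t) := rfl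

lemma contDiff_conv {g ψ : ℂ × ℂ → ℂ} (hg : Continuous g) (hψ : ContDiff ℝ ∞ ψ)
    (hc : HasCompactSupport ψ) : ContDiff ℝ ∞ (conv g ψ) :=
  hc.contDiff_convolution_right _ hg.locallyIntegrable hψ

lemma dirDeriv_conv {g ψ : ℂ × ℂ → ℂ} (hg : Continuous g) (hψ : ContDiff ℝ ∞ ψ)
    (hc : HasCompactSupport ψ) (v : ℂ × ℂ) : dirDeriv v (conv g ψ) = conv g (dirDeriv v ψ) := by
  funext x
  rw [dirDeriv, conv, (hc.hasFDerivAt_convolution_right _ hg.locallyIntegrable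
    (hψ.of_le (by simp)) x).fderiv, convolution_precompR_apply _ hg.locallyIntegrable
    (hc.fderiv ℝ) (hψ.continuous_fderiv (by simp))]
  rfl

lemma HasCompactSupport.dirDeriv {ψ : ℂ × ℂ → ℂ} (hc : HasCompactSupport ψ) (v : ℂ × ℂ) :
    HasCompactSupport (dirDeriv v ψ) :=
  hc.of_isClosed_subset (isClosed_tsupport _) (tsupport_dirDeriv_subset v ψ)

lemma fderiv_comp_line {f : ℂ × ℂ → ℂ} (hf : ContDiff ℝ ∞ f) (x v : ℂ × ℂ) (w a : ℂ) :
    fderiv ℝ (fun w : ℂ => f (x + w • v)) w a = dirDeriv (a • v) f (x + w • v) := by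
  have h1 : HasFDerivAt (fun w : ℂ => x + w • v)
      ((ContinuousLinearMap.id ℝ ℂ).smulRight v) w :=
    ((ContinuousLinearMap.id ℝ ℂ).smulRight v).hasFDerivAt.const_add x
  have h2 := ((hf.differentiable (by simp) (x + w • v)).hasFDerivAt).comp w h1
  have h3 : (fun w : ℂ => f (x + w • v)) = f ∘ (fun w : ℂ => x + w • v) := rfl
  rw [h3, h2.fderiv]
  simp [_root_.dirDeriv]

/-- The directions `1` and `I` of the parameter plane are carried to `v` and `Complex.I • v`. -/
lemma laplacian_comp_line {f : ℂ × ℂ → ℂ} (hf : ContDiff ℝ ∞ f) (x v : ℂ × ℂ) (w : ℂ) :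
    Laplacian.laplacian (fun w : ℂ => f (x + w • v)) w = dirDeriv v (dirDeriv v f) (x + w • v)
      + dirDeriv (Complex.I • v) (dirDeriv (Complex.I • v) f) (x + w • v) := by
  have hS : ContDiff ℝ ∞ (fun w : ℂ => f (x + w • v)) := by fun_prop
  have h2 : ∀ a : ℂ, fderiv ℝ (fderiv ℝ (fun w : ℂ => f (x + w • v))) w a a =
      dirDeriv (a • v) (dirDeriv (a • v) f) (x + w • v) := by
    intro a
    rw [← fderiv_comp_line (hf.dirDeriv (a • v))]
    have h3 : (fun w : ℂ => dirDeriv (a • v) f (x + w • v)) =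
        fun w => fderiv ℝ (fun w : ℂ => f (x + w • v)) w a := by
      funext w; rw [fderiv_comp_line hf]
    rw [h3, fderiv_clm_apply (((contDiff_infty.1 hS 2).fderiv_right (m := 1) (by norm_num)).differentiable (by simp) w)
      (differentiableAt_const a)]
    simp
  rw [InnerProductSpace.laplacian_eq_iteratedFDeriv_complexPlane]
  simp only [iteratedFDeriv_two_apply]
  have h1 := h2 1
  have h3 := h2 Complex.I
  rw [one_smul] at h1
  rw [← h1, ← h3]
  rfl

lemma dirDeriv_comp_sub_left {ψ : ℂ × ℂ → ℂ} (hψ : ContDiff ℝ ∞ ψ) (x v : ℂ × ℂ) :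
    dirDeriv v (fun t => ψ (x - t)) = fun t => -dirDeriv v ψ (x - t) := by
  funext t
  have h1 : HasFDerivAt (fun t => x - t) (-ContinuousLinearMap.id ℝ (ℂ × ℂ)) t :=
    (hasFDerivAt_id t).const_sub x
  have h2 := ((hψ.differentiable (by simp) (x - t)).hasFDerivAt).comp t h1
  have h3 : (fun t => ψ (x - t)) = ψ ∘ fun t => x - t := rfl
  rw [_root_.dirDeriv, h3, h2.fderiv]
  simp [_root_.dirDeriv]

lemma norm_circleAverage_sub_le {E : Type*} [NormedAddCommGroup E] [NormedSpace ℝ E]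
    {f g : ℂ → E} {r ε : ℝ} (hf : Continuous f) (hg : Continuous g)
    (hr : 0 ≤ r) (h : ∀ w ∈ Metric.closedBall (0 : ℂ) r, ‖f w - g w‖ ≤ ε) :
    ‖Real.circleAverage f 0 r - Real.circleAverage g 0 r‖ ≤ ε := by
  have hc : Continuous (circleMap 0 r) := continuous_circleMap 0 r
  rw [Real.circleAverage_def, Real.circleAverage_def, ← smul_sub,
    ← intervalIntegral.integral_sub (f := fun θ => f (circleMap 0 r θ))
      (g := fun θ => g (circleMap 0 r θ)) ((hf.comp hc).intervalIntegrable _ _)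
      ((hg.comp hc).intervalIntegrable _ _), norm_smul]
  have h1 := intervalIntegral.norm_integral_le_of_norm_le_const (a := 0) (b := 2 * Real.pi)
    (f := fun θ => f (circleMap 0 r θ) - g (circleMap 0 r θ)) (C := ε)
    (fun θ _ => h _ (circleMap_mem_closedBall 0 hr θ))
  have hp := Real.pi_pos
  calc _ ≤ ‖(2 * Real.pi)⁻¹‖ * (ε * |2 * Real.pi - 0|) := by gcongr
    _ = ε := by
      rw [sub_zero, abs_of_pos (by positivity), Real.norm_of_nonneg (by positivity)]
      field_simp

/-- A continuous function which is weakly harmonic in direction `v` on `U` satisfies the mean value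
equality on discs in direction `v`. -/
theorem meanEq_of_weakly_harmonic {u : ℂ × ℂ → ℝ} (hu : Continuous u) {U : Set (ℂ × ℂ)}
    (hU : IsOpen U) (v : ℂ × ℂ)
    (h : ∀ ψ : ℂ × ℂ → ℂ, ContDiff ℝ ∞ ψ → HasCompactSupport ψ → tsupport ψ ⊆ U →
      ∫ z, (u z : ℂ) * (dirDeriv v (dirDeriv v ψ) z
        + dirDeriv (Complex.I • v) (dirDeriv (Complex.I • v) ψ) z) = 0) :
    MeanEq v u U := by
  intro z r hr hz
  set g : ℂ × ℂ → ℂ := fun z => (u z : ℂ) with hg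
  have hgc : Continuous g := by fun_prop
  set K : Set (ℂ × ℂ) := (fun w : ℂ => z + w • v) '' Metric.closedBall (0 : ℂ) r with hK
  have hKc : IsCompact K := (isCompact_closedBall 0 r).image (by fun_prop)
  have hKU : K ⊆ U := by rintro _ ⟨w, hw, rfl⟩; exact hz w hw
  have key : Real.circleAverage (fun w => g (z + w • v)) 0 r = g z := by
    -- Mollify: `conv g ρ` is smooth and harmonic along the disc, so it has the mean value property,
    -- and it is within `ε / 2` of `g` both at the centre and on the circle.
    refine eq_of_forall_dist_le fun ε hε => ?_
    obtain ⟨δ₀, hδ₀, hthick⟩ := hKc.exists_cthickening_subset_open hU hKU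
    have huc := hKc.uniformContinuousAt_of_continuousAt g (fun _ _ => hgc.continuousAt)
      (Metric.dist_mem_uniformity (half_pos hε))
    obtain ⟨δ₁, hδ₁, huc⟩ := Metric.mem_uniformity_dist.1 huc
    -- Harmonicity needs a zero Laplacian on a neighbourhood of the disc. Half of `δ₀` pays for that
    -- neighbourhood and half for the radius of the mollifier; `δ₁` controls the oscillation of `g`.
    set δ := min (δ₀ / 2) δ₁ with hδ
    have hδp : 0 < δ := lt_min (half_pos hδ₀) hδ₁
    let b : ContDiffBump (0 : ℂ × ℂ) := ⟨δ / 2, δ, by positivity, by linarith⟩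
    set ρ : ℂ × ℂ → ℂ := fun x => ((b.normed volume x : ℝ) : ℂ) with hρ
    have hρs : ContDiff ℝ ∞ ρ := Complex.ofRealCLM.contDiff.comp b.contDiff_normed
    have hρt : tsupport ρ ⊆ Metric.closedBall 0 δ := by
      refine (closure_mono (t := Function.support (b.normed volume)) ?_).trans ?_
      · intro x hx h0; exact hx (by simp [hρ, h0])
      · exact (b.tsupport_normed_eq (μ := volume)).subset
    have hρc : HasCompactSupport ρ :=
      (isCompact_closedBall _ _).of_isClosed_subset (isClosed_tsupport _) hρt
    have hVs := contDiff_conv hgc hρs hρc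
    have hclose : ∀ x ∈ K, ‖conv g ρ x - g x‖ ≤ ε / 2 := by
      intro x hx
      have h1 : conv g ρ x =
          (b.normed volume ⋆[ContinuousLinearMap.lsmul ℝ ℝ, volume] g : ℂ × ℂ → ℂ) x := by
        rw [convolution_lsmul_swap, conv_apply]
        refine integral_congr_ae (ae_of_all _ fun t => ?_)
        simp [hρ, mul_comm]
      rw [h1, ← dist_eq_norm]
      refine b.dist_normed_convolution_le hgc.aestronglyMeasurable fun y hy => ?_
      have hy' : dist x y < δ₁ := by
        rw [dist_comm]; exact (Metric.mem_ball.1 hy).trans_le (min_le_right _ _)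
      have := huc hy' hx
      rw [dist_comm]
      exact le_of_lt this
    have hlap : ∀ y, Metric.closedBall y δ ⊆ U → dirDeriv v (dirDeriv v (conv g ρ)) y
        + dirDeriv (Complex.I • v) (dirDeriv (Complex.I • v) (conv g ρ)) y = 0 := by
      intro y hy
      -- The Laplacian of the convolution at `y` is the weak Laplacian tested on `t ↦ ρ (y - t)`;
      -- the two sign changes from `y - t` cancel.
      have h2 : ∀ a, dirDeriv a (dirDeriv a (conv g ρ)) y =
          ∫ t, g t * dirDeriv a (dirDeriv a (fun t => ρ (y - t))) t := by
        intro a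
        rw [dirDeriv_conv hgc hρs hρc, dirDeriv_conv hgc (hρs.dirDeriv a) (hρc.dirDeriv a),
          conv_apply]
        refine integral_congr_ae (ae_of_all _ fun t => ?_)
        simp only
        rw [dirDeriv_comp_sub_left hρs, dirDeriv_neg, dirDeriv_comp_sub_left (hρs.dirDeriv a),
          neg_neg]
      have hψs : ContDiff ℝ ∞ (fun t => ρ (y - t)) := by fun_prop
      have hψt : tsupport (fun t => ρ (y - t)) ⊆ Metric.closedBall y δ := by
        refine closure_minimal ?_ Metric.isClosed_closedBall
        intro t ht
        have := hρt (subset_tsupport _ (show y - t ∈ Function.support ρ from ht))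
        rw [Metric.mem_closedBall, dist_comm, dist_eq_norm]
        simpa using this
      have hψc : HasCompactSupport (fun t => ρ (y - t)) :=
        (isCompact_closedBall _ _).of_isClosed_subset (isClosed_tsupport _) hψt
      have hint : ∀ a, Integrable fun t => g t * dirDeriv a (dirDeriv a (fun t => ρ (y - t))) t :=
        fun a => integrable_mul_of_continuousAt_tsupport (fun _ _ => hgc.continuousAt)
          ((hψs.dirDeriv a).dirDeriv a).continuous ((hψc.dirDeriv a).dirDeriv a)
      rw [h2, h2, ← integral_add (hint _) (hint _), ← h _ hψs hψc (hψt.trans hy)]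
      simp only [mul_add, hg]
    have hharm : InnerProductSpace.HarmonicOnNhd (fun w : ℂ => conv g ρ (z + w • v))
        (Metric.closedBall 0 |r|) := by
      rw [abs_of_pos hr]
      intro w hw
      refine ⟨(contDiff_infty.1 (hVs.comp
        (by fun_prop : ContDiff ℝ ∞ fun w : ℂ => z + w • v)) 2).contDiffAt, ?_⟩
      have hnear : ∀ᶠ w' in 𝓝 w, dist (z + w' • v) (z + w • v) < δ :=
        (show Continuous fun w' : ℂ => z + w' • v by fun_prop).continuousAt.eventually
          (Metric.ball_mem_nhds _ hδp)
      filter_upwards [hnear] with w' hw'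
      rw [laplacian_comp_line hVs, hlap]
      · rfl
      · refine Set.Subset.trans (fun y hy => ?_) hthick
        refine Metric.mem_cthickening_of_dist_le y (z + w • v) _ _ ⟨w, hw, rfl⟩ ?_
        have h1 := dist_triangle y (z + w' • v) (z + w • v)
        have h2 := Metric.mem_closedBall.1 hy
        have h3 : δ ≤ δ₀ / 2 := min_le_left _ _
        linarith
    have h3 := hharm.circleAverage_eq
    have h4 := norm_circleAverage_sub_le (f := fun w : ℂ => conv g ρ (z + w • v))
      (g := fun w : ℂ => g (z + w • v)) (r := r) (ε := ε / 2)
      (hVs.continuous.comp (by fun_prop)) (by fun_prop) hr.le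
      (fun w hw => hclose _ ⟨w, hw, rfl⟩)
    rw [h3] at h4
    have h5 := hclose z ⟨0, by simp [hr.le], by simp⟩
    simp only [zero_smul, add_zero] at h4
    rw [dist_eq_norm]
    calc _ = ‖(conv g ρ z - g z) - (conv g ρ z - Real.circleAverage (fun w => g (z + w • v)) 0 r)‖ := by
          congr 1; ring
      _ ≤ ‖conv g ρ z - g z‖ + ‖conv g ρ z - Real.circleAverage (fun w => g (z + w • v)) 0 r‖ :=
          norm_sub_le _ _
      _ ≤ ε := by linarith
  have h6 := Complex.ofRealCLM.circleAverage_comp_comm (f := fun w => u (z + w • v)) (c := 0) (R := r)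
    (Continuous.continuousOn (by fun_prop)).circleIntegrable'
  have h7 : ((Real.circleAverage (fun w => u (z + w • v)) 0 r : ℝ) : ℂ) = u z := by
    rw [← Complex.ofRealCLM_apply, ← h6]; exact key
  exact_mod_cast h7

end Weyl

/-! ### From vanishing currents to mean value equalities -/

section TestForms

/-- The area form of `ℂ`. -/
noncomputable def areaForm : ℂ [⋀^Fin 2]→L[ℝ] ℂ where
  toFun v := (((v 0).re * (v 1).im - (v 0).im * (v 1).re : ℝ) : ℂ)
  map_update_add' m i x y := by
    fin_cases i <;> simp [Function.update] <;> ring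
  map_update_smul' m i c x := by
    fin_cases i <;> simp [Function.update] <;> ring
  cont := by fun_prop
  map_eq_zero_of_eq' v i j hij hne := by
    fin_cases i <;> fin_cases j <;> simp_all <;> ring

lemma areaForm_apply (v : Fin 2 → ℂ) :
    areaForm v = (((v 0).re * (v 1).im - (v 0).im * (v 1).re : ℝ) : ℂ) := rfl

/-- The area form of a factor of `ℂ²`. -/
noncomputable def factorForm (L : (ℂ × ℂ) →L[ℂ] ℂ) : (ℂ × ℂ) [⋀^Fin 2]→L[ℝ] ℂ :=
  areaForm.compContinuousLinearMap (L.restrictScalars ℝ)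

lemma factorForm_apply (L : (ℂ × ℂ) →L[ℂ] ℂ) (a b : ℂ × ℂ) :
    factorForm L ![a, b] = (((L a).re * (L b).im - (L a).im * (L b).re : ℝ) : ℂ) := rfl

lemma tsupport_smul_factorForm_subset (L : (ℂ × ℂ) →L[ℂ] ℂ) (ψ : ℂ × ℂ → ℂ) :
    tsupport (fun z => ψ z • factorForm L) ⊆ tsupport ψ := by
  refine closure_mono fun z hz h => hz ?_
  change ψ z • factorForm L = 0
  rw [h]
  ext v
  simp

lemma isTestForm_smul_factorForm (L : (ℂ × ℂ) →L[ℂ] ℂ) {ψ : ℂ × ℂ → ℂ} (hψ : ContDiff ℝ ∞ ψ)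
    (hc : HasCompactSupport ψ) : IsTestForm (fun z => ψ z • factorForm L) where
  smooth := ((ContinuousLinearMap.toSpanSingleton ℂ (factorForm L)).restrictScalars ℝ).contDiff.comp
    hψ
  compact := hc.of_isClosed_subset (isClosed_tsupport _) (tsupport_smul_factorForm_subset L ψ)
  bidegree z := by
    ext v
    have h : ∀ x, L (mulI x) = Complex.I * L x := by intro x; simp [mulI]
    simp only [ContinuousAlternatingMap.compContinuousLinearMap_apply, factorForm,
      ContinuousAlternatingMap.smul_apply, areaForm_apply]
    congr 2
    simp [h]
    ring

lemma formCoeff_smul_factorForm (L : (ℂ × ℂ) →L[ℂ] ℂ) (ψ : ℂ × ℂ → ℂ) (a b : ℂ × ℂ) :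
    formCoeff (fun z => ψ z • factorForm L) a b =
      fun z => ψ z * (((L a).re * (L b).im - (L a).im * (L b).re : ℝ) : ℂ) := by
  funext z
  simp only [formCoeff, ContinuousAlternatingMap.smul_apply, factorForm_apply, smul_eq_mul]

lemma dirDeriv_zero (v : ℂ × ℂ) : dirDeriv v (fun _ => 0) = fun _ => 0 := by
  funext z; simp [dirDeriv]

/-- The form `ψ dx₂ ∧ dy₂` has a single nonzero coefficient among the four, and `dd^c` pairs it with
the Laplacian in the first variable. Testing against such forms turns a vanishing current into weak
harmonicity on horizontal lines. -/
lemma ddcCoeff_smul_factorForm_snd {ψ : ℂ × ℂ → ℂ} (hψ : ContDiff ℝ ∞ ψ)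
    (hc : HasCompactSupport ψ) (z : ℂ × ℂ) :
    ddcCoeff (fun z => ψ z • factorForm (ContinuousLinearMap.snd ℂ ℂ ℂ)) z =
      dirDeriv (1, 0) (dirDeriv (1, 0) ψ) z +
        dirDeriv (Complex.I, 0) (dirDeriv (Complex.I, 0) ψ) z := by
  have h := isTestForm_smul_factorForm (ContinuousLinearMap.snd ℂ ℂ ℂ) hψ hc
  rw [ddcCoeff_eq h.smooth h.bidegree]
  simp only [formCoeff_smul_factorForm]
  simp [dirDeriv_zero]

lemma ddcCoeff_smul_factorForm_fst {ψ : ℂ × ℂ → ℂ} (hψ : ContDiff ℝ ∞ ψ)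
    (hc : HasCompactSupport ψ) (z : ℂ × ℂ) :
    ddcCoeff (fun z => ψ z • factorForm (ContinuousLinearMap.fst ℂ ℂ ℂ)) z =
      dirDeriv (0, 1) (dirDeriv (0, 1) ψ) z +
        dirDeriv (0, Complex.I) (dirDeriv (0, Complex.I) ψ) z := by
  have h := isTestForm_smul_factorForm (ContinuousLinearMap.fst ℂ ℂ ℂ) hψ hc
  rw [ddcCoeff_eq h.smooth h.bidegree]
  simp only [formCoeff_smul_factorForm]
  simp [dirDeriv_zero]

lemma integral_eq_zero_of_ddcCurrent_eq_zero {u : ℂ × ℂ → ℝ} {φ : TwoForm}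
    (h : ddcCurrent u φ = 0) : ∫ z, (u z : ℂ) * ddcCoeff φ z = 0 := by
  rw [ddcCurrent, mul_eq_zero] at h
  refine h.resolve_left ?_
  have := Real.pi_ne_zero
  exact_mod_cast (by positivity : (1 / (2 * Real.pi) : ℝ) ≠ 0)

/-- A continuous function which is weakly pluriharmonic on `U` satisfies the mean value equality
on horizontal and vertical discs. -/
theorem meanEq_of_ddcCurrent_eq_zero {u : ℂ × ℂ → ℝ} (hu : Continuous u) {U : Set (ℂ × ℂ)}
    (hU : IsOpen U) (h : ∀ φ, IsTestForm φ → tsupport φ ⊆ U → ddcCurrent u φ = 0) :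
    MeanEq (1, 0) u U ∧ MeanEq (0, 1) u U := by
  constructor
  · refine meanEq_of_weakly_harmonic hu hU _ fun ψ hψ hc ht => ?_
    have := integral_eq_zero_of_ddcCurrent_eq_zero (h _ (isTestForm_smul_factorForm
      (ContinuousLinearMap.snd ℂ ℂ ℂ) hψ hc) ((tsupport_smul_factorForm_subset _ ψ).trans ht))
    simpa [ddcCoeff_smul_factorForm_snd hψ hc] using this
  · refine meanEq_of_weakly_harmonic hu hU _ fun ψ hψ hc ht => ?_
    have := integral_eq_zero_of_ddcCurrent_eq_zero (h _ (isTestForm_smul_factorForm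
      (ContinuousLinearMap.fst ℂ ℂ ℂ) hψ hc) ((tsupport_smul_factorForm_subset _ ψ).trans ht))
    simpa [ddcCoeff_smul_factorForm_fst hψ hc] using this

end TestForms

/-! ### The minimum principle on discs and bidiscs. -/

section Minimum

/-- Minimum principle: the circle through `w` has average zero, and a continuous nonnegative
function that is positive somewhere on the circle would have positive average. -/
lemma MeanEq.eq_zero_on_disc {v : ℂ × ℂ} {u : ℂ × ℂ → ℝ} {U : Set (ℂ × ℂ)} (h : MeanEq v u U)
    (hu : Continuous u) (h0 : ∀ z, 0 ≤ u z) {z : ℂ × ℂ} (hz : u z = 0) {r : ℝ}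
    (hr : ∀ w ∈ Metric.closedBall (0 : ℂ) r, z + w • v ∈ U) {w : ℂ}
    (hw : w ∈ Metric.closedBall (0 : ℂ) r) : u (z + w • v) = 0 := by
  rcases eq_or_ne w 0 with rfl | hne
  · simpa using hz
  have hs : 0 < ‖w‖ := norm_pos_iff.2 hne
  have hwr : ‖w‖ ≤ r := by simpa using hw
  have h1 := h z ‖w‖ hs fun w' hw' => hr w' (Metric.closedBall_subset_closedBall hwr hw')
  have hw' : w ∈ circleMap 0 ‖w‖ '' Set.Ioc 0 (2 * Real.pi) := by
    rw [image_circleMap_Ioc]; simp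
  obtain ⟨θ, hθ, hθw⟩ := hw'
  by_contra hcon
  have hpos : 0 < u (z + w • v) := lt_of_le_of_ne (h0 _) (Ne.symm hcon)
  have hc : Continuous (circleMap 0 ‖w‖) := continuous_circleMap 0 ‖w‖
  have hint : 0 < ∫ θ in (0 : ℝ)..2 * Real.pi, u (z + circleMap 0 ‖w‖ θ • v) := by
    refine intervalIntegral.integral_pos Real.two_pi_pos (Continuous.continuousOn (by fun_prop))
      (fun _ _ => h0 _) ⟨θ, Set.Ioc_subset_Icc_self hθ, ?_⟩
    rwa [hθw]
  rw [Real.circleAverage_def, hz, smul_eq_mul] at h1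
  have : 0 < (2 * Real.pi)⁻¹ := by have := Real.pi_pos; positivity
  nlinarith [mul_pos this hint]

/-- Balls of the sup norm are bidiscs, so a horizontal disc followed by a vertical one reaches every
nearby point; zeros spread along each. -/
lemma eventually_eq_zero_of_meanEq {u : ℂ × ℂ → ℝ} {U : Set (ℂ × ℂ)} (hU : IsOpen U)
    (h1 : MeanEq (1, 0) u U) (h2 : MeanEq (0, 1) u U) (hu : Continuous u) (h0 : ∀ z, 0 ≤ u z)
    {z : ℂ × ℂ} (hzU : z ∈ U) (hz : u z = 0) : ∀ᶠ w in 𝓝 z, u w = 0 := by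
  obtain ⟨r, hr, hrU⟩ := Metric.nhds_basis_closedBall.mem_iff.1 (hU.mem_nhds hzU)
  have hmem : ∀ a b : ℂ, ‖a‖ ≤ r → ‖b‖ ≤ r → z + (a, b) ∈ U := by
    intro a b ha hb
    refine hrU ?_
    rw [mem_closedBall_iff_norm, add_sub_cancel_left]
    exact max_le ha hb
  filter_upwards [Metric.closedBall_mem_nhds z hr] with w hw
  rw [mem_closedBall_iff_norm] at hw
  have ha : ‖(w - z).1‖ ≤ r := (norm_fst_le _).trans hw
  have hb : ‖(w - z).2‖ ≤ r := (norm_snd_le _).trans hw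
  have e1 := h1.eq_zero_on_disc hu h0 hz (r := r) (w := (w - z).1) (fun a ha' => by
    simpa using hmem a 0 (by simpa using ha') (by simpa using hr.le)) (by simpa using ha)
  have e2 := h2.eq_zero_on_disc hu h0 e1 (r := r) (w := (w - z).2) (fun b hb' => by
    have := hmem (w - z).1 b ha (by simpa using hb')
    rw [add_assoc]; simpa using this) (by simpa using hb)
  rw [add_assoc] at e2
  convert e2 using 2
  ext <;> simp

end Minimum

/-! ### Maps with Hénon-like filtration -/

section HenonLike

/-- The escape region of the coordinate `c` at scale `R`. -/
def escapeSet (c : ℂ × ℂ → ℂ) (R : ℝ) : Set (ℂ × ℂ) := {z | ‖z‖ ≤ ‖c z‖ ∧ R ≤ ‖c z‖}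

/-- The filtration properties of a Hénon map: `c` is the dominating coordinate, `d` the degree. -/
structure HenonLike (c : ℂ × ℂ → ℂ) (R : ℝ) (d : ℕ) (C : ℝ) (F : ℂ × ℂ → ℂ × ℂ) : Prop where
  mem_interior : ∀ z ∈ escapeSet c R, F z ∈ interior (escapeSet c R)
  two_mul_le : ∀ z ∈ escapeSet c R, 2 * ‖c z‖ ≤ ‖c (F z)‖
  abs_log_sub_le : ∀ z ∈ escapeSet c R, |Real.log ‖c (F z)‖ - d * Real.log ‖c z‖| ≤ C
  of_notMem : ∀ z ∉ escapeSet c R, F z ∈ escapeSet c R ∨ ‖F z‖ ≤ max ‖z‖ R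
  log_le : ∀ z, Real.log (max ‖F z‖ R) ≤ d * Real.log (max ‖z‖ R) + C

lemma HenonLike.comp {c : ℂ × ℂ → ℂ} {R C₁ C₂ : ℝ} {d₁ d₂ : ℕ} {F₁ F₂ : ℂ × ℂ → ℂ × ℂ}
    (h₂ : HenonLike c R d₂ C₂ F₂) (h₁ : HenonLike c R d₁ C₁ F₁) :
    HenonLike c R (d₂ * d₁) (C₂ + d₂ * C₁) (fun z => F₂ (F₁ z)) where
  mem_interior z hz := h₂.mem_interior _ (interior_subset (h₁.mem_interior z hz))
  two_mul_le z hz := by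
    have a := h₁.two_mul_le z hz
    have b := h₂.two_mul_le _ (interior_subset (h₁.mem_interior z hz))
    have := norm_nonneg (c (F₁ z))
    linarith
  abs_log_sub_le z hz := by
    have a := h₁.abs_log_sub_le z hz
    have b := h₂.abs_log_sub_le _ (interior_subset (h₁.mem_interior z hz))
    push_cast
    calc _ = |(Real.log ‖c (F₂ (F₁ z))‖ - d₂ * Real.log ‖c (F₁ z)‖)
          + d₂ * (Real.log ‖c (F₁ z)‖ - d₁ * Real.log ‖c z‖)| := by congr 1; ring
      _ ≤ _ := by
        refine (abs_add_le _ _).trans (add_le_add b ?_)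
        rw [abs_mul, Nat.abs_cast]
        gcongr
  of_notMem z hz := by
    by_cases h : F₁ z ∈ escapeSet c R
    · exact Or.inl (interior_subset (h₂.mem_interior _ h))
    · rcases h₂.of_notMem _ h with h' | h'
      · exact Or.inl h'
      · exact Or.inr (h'.trans (max_le ((h₁.of_notMem z hz).resolve_left h) (le_max_right _ _)))
  log_le z := by
    have a := h₁.log_le z
    have b := h₂.log_le (F₁ z)
    push_cast
    calc _ ≤ d₂ * Real.log (max ‖F₁ z‖ R) + C₂ := b
      _ ≤ d₂ * (d₁ * Real.log (max ‖z‖ R) + C₁) + C₂ := by gcongr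
      _ = _ := by ring

lemma norm_sum_coeff_mul_pow_le (q : Polynomial ℂ) (n : ℕ) (y : ℂ) {s : ℝ} (hs : 1 ≤ s)
    (hy : ‖y‖ ≤ s) {k : ℕ} (hn : n ≤ k + 1) :
    ‖∑ i ∈ Finset.range n, q.coeff i * y ^ i‖ ≤ (∑ i ∈ Finset.range n, ‖q.coeff i‖) * s ^ k := by
  rw [Finset.sum_mul]
  refine norm_sum_le_of_le _ fun i hi => ?_
  rw [norm_mul, norm_pow]
  have hi' := Finset.mem_range.1 hi
  gcongr
  exact (pow_le_pow_left₀ (norm_nonneg _) hy i).trans (pow_le_pow_right₀ hs (by omega))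

/-- In the escape region the lower terms total at most `B ‖c z‖ ^ (D - 1)`. The bound `2 * B / α ≤
R` makes this at most half the leading term, and `4 / α ≤ R` turns the remaining half into a
doubling. The leading coefficient is not assumed to be `1`, since inverse Hénon maps have leading
coefficient `1 / a`. -/
lemma henonLike_of_coeff_bounds {c c' : ℂ × ℂ → ℂ} (hc : Continuous c) (hc' : Continuous c')
    (hnorm : ∀ z, ‖z‖ = max ‖c z‖ ‖c' z‖) {F : ℂ × ℂ → ℂ × ℂ} {q : Polynomial ℂ} {b : ℂ} {D : ℕ}
    (hD : 2 ≤ D) (hq : q.natDegree = D) (h₁ : ∀ z, c' (F z) = c z)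
    (h₂ : ∀ z, c (F z) = q.eval (c z) - b * c' z) {α B R : ℝ} (hα : 0 < α)
    (hlead : α ≤ ‖q.coeff D‖) (hB : 1 ≤ B)
    (hsum : ∑ i ∈ Finset.range (D + 1), ‖q.coeff i‖ + ‖b‖ ≤ B) (hR : 1 ≤ R)
    (hR₁ : 2 * B / α ≤ R) (hR₂ : 4 / α ≤ R) :
    HenonLike c R D (|Real.log (α / 2)| + Real.log (2 * B)) F := by
  obtain ⟨k, rfl⟩ : ∃ k, D = k + 1 := ⟨D - 1, by omega⟩
  have hk : 1 ≤ k := by omega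
  have heval : ∀ y, q.eval y = ∑ i ∈ Finset.range (k + 1), q.coeff i * y ^ i
      + q.coeff (k + 1) * y ^ (k + 1) := by
    intro y
    rw [Polynomial.eval_eq_sum_range, hq, Finset.sum_range_succ]
  rw [Finset.sum_range_succ] at hsum
  have hlog2B : 0 ≤ Real.log (2 * B) := Real.log_nonneg (by linarith)
  have hbn := norm_nonneg b
  have hSn : 0 ≤ ∑ i ∈ Finset.range (k + 1), ‖q.coeff i‖ := Finset.sum_nonneg fun _ _ => norm_nonneg _
  have hln := norm_nonneg (q.coeff (k + 1))
  have main : ∀ z ∈ escapeSet c R, α / 2 * ‖c z‖ ^ (k + 1) ≤ ‖c (F z)‖ ∧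
      ‖c (F z)‖ ≤ 2 * B * ‖c z‖ ^ (k + 1) := by
    rintro z ⟨hz1, hz2⟩
    have hy1 : 1 ≤ ‖c z‖ := hR.trans hz2
    have hx : ‖c' z‖ ≤ ‖c z‖ := (le_max_right _ _).trans ((hnorm z).symm.le.trans hz1)
    set Y := ‖c z‖ with hY
    have hrest : ‖c (F z) - q.coeff (k + 1) * c z ^ (k + 1)‖ ≤ B * Y ^ k := by
      rw [h₂, heval]
      have e1 := norm_sum_coeff_mul_pow_le q (k + 1) (c z) hy1 le_rfl (k := k) le_rfl
      have e2 : ‖b * c' z‖ ≤ ‖b‖ * Y ^ k := by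
        rw [norm_mul]
        gcongr
        calc ‖c' z‖ ≤ Y ^ 1 := by simpa using hx
          _ ≤ Y ^ k := pow_le_pow_right₀ hy1 hk
      calc _ = ‖∑ i ∈ Finset.range (k + 1), q.coeff i * c z ^ i - b * c' z‖ := by congr 1; ring
        _ ≤ _ := (norm_sub_le _ _).trans (add_le_add e1 e2)
        _ = (∑ i ∈ Finset.range (k + 1), ‖q.coeff i‖ + ‖b‖) * Y ^ k := by ring
        _ ≤ _ := by gcongr; linarith
    have hYk : 0 < Y ^ k := by positivity
    have hmain : B * Y ^ k ≤ α / 2 * Y ^ (k + 1) := by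
      have : 2 * B ≤ α * Y := by
        rw [div_le_iff₀ hα] at hR₁; nlinarith
      rw [pow_succ]
      nlinarith
    have hnl : ‖q.coeff (k + 1) * c z ^ (k + 1)‖ = ‖q.coeff (k + 1)‖ * Y ^ (k + 1) := by
      rw [norm_mul, norm_pow]
    have hYk1 : 0 < Y ^ (k + 1) := by positivity
    constructor
    · have := norm_sub_norm_le (q.coeff (k + 1) * c z ^ (k + 1)) (c (F z))
      rw [norm_sub_rev, hnl] at this
      have := mul_le_mul_of_nonneg_right hlead hYk1.le
      linarith
    · have := norm_sub_norm_le (c (F z)) (q.coeff (k + 1) * c z ^ (k + 1))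
      rw [hnl] at this
      have h3 : Y ^ k ≤ Y ^ (k + 1) := pow_le_pow_right₀ hy1 (by omega)
      have h4 : ‖q.coeff (k + 1)‖ * Y ^ (k + 1) ≤ B * Y ^ (k + 1) := by
        gcongr; linarith
      have h5 : B * Y ^ k ≤ B * Y ^ (k + 1) := by gcongr
      linarith
  have two : ∀ z ∈ escapeSet c R, 2 * ‖c z‖ ≤ ‖c (F z)‖ := by
    intro z hz
    refine le_trans ?_ (main z hz).1
    have hy1 : 1 ≤ ‖c z‖ := hR.trans hz.2
    have h4 : 4 ≤ α * ‖c z‖ := by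
      rw [div_le_iff₀ hα] at hR₂; nlinarith [hz.2]
    have h5 : ‖c z‖ ^ 1 ≤ ‖c z‖ ^ k := pow_le_pow_right₀ hy1 hk
    rw [pow_one] at h5
    calc 2 * ‖c z‖ ≤ α * ‖c z‖ / 2 * ‖c z‖ := by nlinarith
      _ ≤ α * ‖c z‖ ^ k / 2 * ‖c z‖ := by gcongr
      _ = _ := by ring
  refine ⟨fun z hz => ?_, two, fun z hz => ?_, fun z hz => ?_, fun z => ?_⟩
  · have hopen : IsOpen {w | ‖c' w‖ < ‖c w‖ ∧ R < ‖c w‖} :=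
      (isOpen_lt hc'.norm hc.norm).and (isOpen_lt continuous_const hc.norm)
    refine interior_maximal ?_ hopen ?_
    · rintro w ⟨hw1, hw2⟩
      exact ⟨(hnorm w).le.trans (max_le le_rfl hw1.le), hw2.le⟩
    · have := two z hz
      have h0 : 0 < ‖c z‖ := by linarith [hz.2]
      refine ⟨?_, ?_⟩
      · rw [h₁]; linarith
      · linarith [hz.2]
  · have h0 : 0 < ‖c z‖ := by linarith [hz.2]
    obtain ⟨m1, m2⟩ := main z hz
    have h1 := Real.log_le_log (by positivity) m1
    have h3 := Real.log_le_log (lt_of_lt_of_le (by positivity) m1) m2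
    rw [Real.log_mul (by positivity) (by positivity), Real.log_pow] at h1 h3
    rw [abs_le]
    have := neg_abs_le (Real.log (α / 2))
    have := abs_nonneg (Real.log (α / 2))
    constructor <;> linarith
  -- As `c' (F z) = c z`, these two inequalities put `F z` in the escape region. If either fails,
  -- `‖c (F z)‖` is less than `‖c z‖` or less than `R`.
  · by_cases h : ‖c z‖ ≤ ‖c (F z)‖ ∧ R ≤ ‖c (F z)‖
    · left
      refine ⟨?_, h.2⟩
      rw [hnorm (F z), h₁]
      exact max_le le_rfl h.1
    · right
      have hcz : ‖c z‖ ≤ max ‖z‖ R := ((le_max_left _ _).trans (hnorm z).symm.le).trans (le_max_left _ _)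
      rw [hnorm (F z), h₁]
      refine max_le ?_ hcz
      rcases not_and_or.1 h with h | h
      · exact (not_le.1 h).le.trans hcz
      · exact (not_le.1 h).le.trans (le_max_right _ _)
  · set m := max ‖z‖ R with hm
    have hm1 : 1 ≤ m := hR.trans (le_max_right _ _)
    have hcz : ‖c z‖ ≤ m := ((le_max_left _ _).trans (hnorm z).symm.le).trans (le_max_left _ _)
    have hcz' : ‖c' z‖ ≤ m := ((le_max_right _ _).trans (hnorm z).symm.le).trans (le_max_left _ _)
    have hmm : m ≤ m ^ (k + 1) := le_self_pow₀ hm1 (by omega)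
    have e0 : ‖c (F z)‖ ≤ B * m ^ (k + 1) := by
      rw [h₂, heval, ← Finset.sum_range_succ (fun i => q.coeff i * c z ^ i)]
      have e1 := norm_sum_coeff_mul_pow_le q (k + 1 + 1) (c z) hm1 hcz (k := k + 1) le_rfl
      have e2 : ‖b * c' z‖ ≤ ‖b‖ * m ^ (k + 1) := by
        rw [norm_mul]
        gcongr
        exact hcz'.trans hmm
      refine ((norm_sub_le _ _).trans (add_le_add e1 e2)).trans ?_
      rw [← add_mul, Finset.sum_range_succ]
      gcongr
    have hB' : m ^ (k + 1) ≤ B * m ^ (k + 1) := le_mul_of_one_le_left (by positivity) hB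
    have e3 : max ‖F z‖ R ≤ 2 * B * m ^ (k + 1) := by
      have : 0 ≤ B * m ^ (k + 1) := by positivity
      rw [hnorm (F z), h₁]
      refine max_le (max_le ?_ ?_) ?_
      · linarith
      · linarith
      · have := le_max_right ‖z‖ R
        linarith
    have h1 := Real.log_le_log (lt_of_lt_of_le (by linarith) (le_max_right ‖F z‖ R)) e3
    rw [Real.log_mul (by positivity) (by positivity), Real.log_pow] at h1
    have := abs_nonneg (Real.log (α / 2))
    linarith

/-- A compact continuous family of (generalized, inverse) Hénon maps is Hénon-like uniformly, at
all large scales. -/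
lemma eventually_henonLike {M : Type*} [TopologicalSpace M] [CompactSpace M] [Nonempty M]
    {c c' : ℂ × ℂ → ℂ} (hc : Continuous c) (hc' : Continuous c')
    (hnorm : ∀ z, ‖z‖ = max ‖c z‖ ‖c' z‖) {F : M → ℂ × ℂ → ℂ × ℂ} {q : M → Polynomial ℂ}
    {b : M → ℂ} {D : ℕ} (hD : 2 ≤ D) (hq : ∀ t, (q t).natDegree = D)
    (hcoeff : ∀ i, Continuous fun t => (q t).coeff i) (hb : Continuous b)
    (h₁ : ∀ t z, c' (F t z) = c z) (h₂ : ∀ t z, c (F t z) = (q t).eval (c z) - b t * c' z) :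
    ∀ᶠ R in atTop, ∃ C, ∀ t, HenonLike c R D C (F t) := by
  -- Compactness provides uniform `α` and `B`: the least modulus of the leading coefficient and the
  -- largest coefficient sum.
  obtain ⟨t₀, -, ht₀⟩ := isCompact_univ.exists_isMinOn Set.univ_nonempty
    (f := fun t => ‖(q t).coeff D‖) (hcoeff D).norm.continuousOn
  have hα : 0 < ‖(q t₀).coeff D‖ := by
    rw [norm_pos_iff, ← hq t₀, Polynomial.coeff_natDegree]
    intro h
    have := hq t₀
    rw [Polynomial.leadingCoeff_eq_zero.1 h, Polynomial.natDegree_zero] at this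
    omega
  obtain ⟨t₁, -, ht₁⟩ := isCompact_univ.exists_isMaxOn Set.univ_nonempty
    (f := fun t => ∑ i ∈ Finset.range (D + 1), ‖(q t).coeff i‖ + ‖b t‖)
    (Continuous.continuousOn (by fun_prop))
  set α := ‖(q t₀).coeff D‖
  set B := max 1 (∑ i ∈ Finset.range (D + 1), ‖(q t₁).coeff i‖ + ‖b t₁‖)
  filter_upwards [eventually_ge_atTop 1, eventually_ge_atTop (2 * B / α),
    eventually_ge_atTop (4 / α)] with R hR1 hR2 hR3
  exact ⟨_, fun t => henonLike_of_coeff_bounds hc hc' hnorm hD (hq t) (h₁ t) (h₂ t) hα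
    (ht₀ (Set.mem_univ t)) (le_max_left _ _) ((ht₁ (Set.mem_univ t)).trans (le_max_right _ _))
    hR1 hR2 hR3⟩

end HenonLike

/-! ### Random iteration of Hénon-like maps -/

/-- A continuous family of holomorphic maps with a common Hénon-like filtration. -/
structure EscapeSystem (M : Type*) [TopologicalSpace M] where
  F : M → ℂ × ℂ → ℂ × ℂ
  c : (ℂ × ℂ) →L[ℂ] ℂ
  R : ℝ
  C : ℝ
  d : ℕ
  one_le_R : 1 ≤ R
  C_nonneg : 0 ≤ C
  two_le_d : 2 ≤ d
  norm_c_le : ∀ z, ‖c z‖ ≤ ‖z‖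
  henonLike : ∀ t, HenonLike c R d C (F t)
  continuous_F : Continuous fun p : M × (ℂ × ℂ) => F p.1 p.2
  contDiff_F : ∀ t, ContDiff ℂ ∞ (F t)

namespace EscapeSystem

variable {M : Type*} [TopologicalSpace M] (S : EscapeSystem M)

/-- The random iterates. -/
def iter (L : ℕ → M) : ℕ → ℂ × ℂ → ℂ × ℂ
  | 0, z => z
  | n + 1, z => S.F (L n) (iter L n z)

/-- The truncated logarithm of the norm. -/
noncomputable def logMax (z : ℂ × ℂ) : ℝ := Real.log (max ‖z‖ S.R)

/-- The approximants `d^{-n} log max(‖F_n(z)‖, R)` of the Green function. -/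
noncomputable def approx (L : ℕ → M) (n : ℕ) (z : ℂ × ℂ) : ℝ :=
  ((S.d : ℝ) ^ n)⁻¹ * S.logMax (S.iter L n z)

/-- The Green function. -/
noncomputable def G (L : ℕ → M) (z : ℂ × ℂ) : ℝ := limUnder atTop fun n => S.approx L n z

/-- A rate constant for the convergence of the approximants. -/
noncomputable def rate (z : ℂ × ℂ) : ℝ := S.C + 2 * S.logMax z

/-- The points with bounded orbit. -/
def K (L : ℕ → M) : Set (ℂ × ℂ) := {z | Bornology.IsBounded (Set.range fun n => S.iter L n z)}

lemma iter_consSeq (t : M) (L : ℕ → M) (n : ℕ) (z : ℂ × ℂ) :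
    S.iter (consSeq t L) (n + 1) z = S.iter L n (S.F t z) := by
  induction n with
  | zero => rfl
  | succ n ih => rw [iter, ih]; rfl

lemma continuous_iter (n : ℕ) :
    Continuous fun p : (ℕ → M) × (ℂ × ℂ) => S.iter p.1 n p.2 := by
  induction n with
  | zero => exact continuous_snd
  | succ n ih =>
    exact S.continuous_F.comp (((continuous_apply n).comp continuous_fst).prodMk ih)

lemma contDiff_iter (L : ℕ → M) (n : ℕ) : ContDiff ℂ ∞ (S.iter L n) := by
  induction n with
  | zero => exact contDiff_id
  | succ n ih => exact (S.contDiff_F (L n)).comp ih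

lemma max_pos (z : ℂ × ℂ) : 1 ≤ max ‖z‖ S.R := S.one_le_R.trans (le_max_right _ _)

lemma logMax_nonneg (z : ℂ × ℂ) : 0 ≤ S.logMax z := Real.log_nonneg (S.max_pos z)

lemma continuous_logMax : Continuous S.logMax :=
  (Continuous.max continuous_norm continuous_const).log
    fun z => (lt_of_lt_of_le one_pos (S.max_pos z)).ne'

lemma rate_nonneg (z : ℂ × ℂ) : 0 ≤ S.rate z := by
  have := S.logMax_nonneg z
  have := S.C_nonneg
  unfold rate; linarith

lemma continuous_rate : Continuous S.rate :=
  continuous_const.add (continuous_const.mul S.continuous_logMax)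

lemma continuous_approx (n : ℕ) :
    Continuous fun p : (ℕ → M) × (ℂ × ℂ) => S.approx p.1 n p.2 :=
  continuous_const.mul (S.continuous_logMax.comp (S.continuous_iter n))

lemma d_pos : (0 : ℝ) < S.d := by
  have := S.two_le_d
  exact_mod_cast (by omega : 0 < S.d)

lemma two_le_d_real : (2 : ℝ) ≤ S.d := by exact_mod_cast S.two_le_d

lemma approx_nonneg (L : ℕ → M) (n : ℕ) (z : ℂ × ℂ) : 0 ≤ S.approx L n z :=
  mul_nonneg (inv_nonneg.2 (pow_nonneg S.d_pos.le n)) (S.logMax_nonneg _)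

lemma logMax_of_mem {z : ℂ × ℂ} (hz : z ∈ escapeSet S.c S.R) :
    S.logMax z = Real.log ‖S.c z‖ := by
  have h : ‖z‖ = ‖S.c z‖ := le_antisymm hz.1 (S.norm_c_le z)
  rw [logMax, h, max_eq_left hz.2]

lemma iter_mem_interior {L : ℕ → M} {n : ℕ} {z : ℂ × ℂ} (h : S.iter L n z ∈ escapeSet S.c S.R)
    {m : ℕ} (hm : n < m) : S.iter L m z ∈ interior (escapeSet S.c S.R) := by
  induction m, hm using Nat.le_induction with
  | base => exact (S.henonLike (L n)).mem_interior _ h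
  | succ m _ ih => exact (S.henonLike (L m)).mem_interior _ (interior_subset ih)

lemma iter_mem {L : ℕ → M} {n : ℕ} {z : ℂ × ℂ} (h : S.iter L n z ∈ escapeSet S.c S.R)
    {m : ℕ} (hm : n ≤ m) : S.iter L m z ∈ escapeSet S.c S.R := by
  rcases hm.eq_or_lt with rfl | hm
  · exact h
  · exact interior_subset (S.iter_mem_interior h hm)

/-- An orbit outside the escape region at time `n` was outside at all earlier times, by forward
invariance, so no step raised its norm above `max ‖z‖ R`. -/
lemma max_norm_iter_le {L : ℕ → M} {n : ℕ} {z : ℂ × ℂ} (h : S.iter L n z ∉ escapeSet S.c S.R) :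
    max ‖S.iter L n z‖ S.R ≤ max ‖z‖ S.R := by
  induction n with
  | zero => exact le_rfl
  | succ n ih =>
    have h' : S.iter L n z ∉ escapeSet S.c S.R := fun h' => h (S.iter_mem h' n.le_succ)
    exact (max_le (((S.henonLike (L n)).of_notMem _ h').resolve_left h) (le_max_right _ _)).trans
      (ih h')

lemma logMax_iter_le {L : ℕ → M} {n : ℕ} {z : ℂ × ℂ} (h : S.iter L n z ∉ escapeSet S.c S.R) :
    S.logMax (S.iter L n z) ≤ S.logMax z :=
  Real.log_le_log (lt_of_lt_of_le one_pos (S.max_pos _)) (S.max_norm_iter_le h)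

lemma inv_pow_le (n : ℕ) : ((S.d : ℝ) ^ n)⁻¹ ≤ (1 / 2) ^ n := by
  rw [one_div, inv_pow]
  exact inv_anti₀ (by positivity) (pow_le_pow_left₀ (by norm_num) S.two_le_d_real n)

lemma abs_approx_succ_sub_le_of_mem {L : ℕ → M} {n : ℕ} {z : ℂ × ℂ}
    (h : S.iter L n z ∈ escapeSet S.c S.R) :
    |S.approx L (n + 1) z - S.approx L n z| ≤ ((S.d : ℝ) ^ (n + 1))⁻¹ * S.C := by
  have h1 := (S.henonLike (L n)).abs_log_sub_le _ h
  have hd := S.d_pos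
  have e : S.approx L (n + 1) z - S.approx L n z = ((S.d : ℝ) ^ (n + 1))⁻¹ *
      (Real.log ‖S.c (S.iter L (n + 1) z)‖ - S.d * Real.log ‖S.c (S.iter L n z)‖) := by
    rw [approx, approx, S.logMax_of_mem h, S.logMax_of_mem (S.iter_mem h n.le_succ), pow_succ]
    field_simp
  rw [e, abs_mul, abs_of_nonneg (by positivity)]
  gcongr
  exact h1

/-- Inside the escape region the increment is at most `C / d ^ (n + 1)`. Outside it the orbit has
not yet grown, so both approximants are themselves of order `d^{-n}`. The bound is uniform in `L`,
which is what makes `G` jointly continuous. -/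
lemma abs_approx_succ_sub_le (L : ℕ → M) (n : ℕ) (z : ℂ × ℂ) :
    |S.approx L (n + 1) z - S.approx L n z| ≤ S.rate z * (1 / 2) ^ n := by
  have hd := S.d_pos
  have hC := S.C_nonneg
  have hz := S.logMax_nonneg z
  have hd1 : ((S.d : ℝ) ^ (n + 1))⁻¹ ≤ ((S.d : ℝ) ^ n)⁻¹ :=
    inv_anti₀ (by positivity) (pow_le_pow_right₀ (by linarith [S.two_le_d_real]) n.le_succ)
  have hfin : ∀ x, x ≤ ((S.d : ℝ) ^ n)⁻¹ * S.rate z → x ≤ S.rate z * (1 / 2) ^ n := by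
    intro x hx
    refine hx.trans ?_
    rw [mul_comm]
    exact mul_le_mul_of_nonneg_left (S.inv_pow_le n) (S.rate_nonneg z)
  apply hfin
  by_cases h : S.iter L n z ∈ escapeSet S.c S.R
  · refine (S.abs_approx_succ_sub_le_of_mem h).trans ?_
    refine mul_le_mul hd1 ?_ hC (by positivity)
    unfold rate; linarith
  · have h1 : S.logMax (S.iter L (n + 1) z) ≤ S.d * S.logMax (S.iter L n z) + S.C :=
      (S.henonLike (L n)).log_le _
    have h2 := S.logMax_iter_le h
    have h3 : S.approx L n z ≤ ((S.d : ℝ) ^ n)⁻¹ * S.logMax z := by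
      unfold approx; gcongr
    have h4 : S.approx L (n + 1) z ≤ ((S.d : ℝ) ^ n)⁻¹ * (S.logMax z + S.C) := by
      unfold approx
      calc _ ≤ ((S.d : ℝ) ^ (n + 1))⁻¹ * (S.d * S.logMax (S.iter L n z) + S.C) := by gcongr
        _ = ((S.d : ℝ) ^ n)⁻¹ * S.logMax (S.iter L n z) + ((S.d : ℝ) ^ (n + 1))⁻¹ * S.C := by
          rw [pow_succ]; field_simp
        _ ≤ ((S.d : ℝ) ^ n)⁻¹ * S.logMax z + ((S.d : ℝ) ^ n)⁻¹ * S.C := by gcongr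
        _ = _ := by ring
    have h5 := S.approx_nonneg L n z
    have h6 := S.approx_nonneg L (n + 1) z
    have h7 : ((S.d : ℝ) ^ n)⁻¹ * S.rate z = ((S.d : ℝ) ^ n)⁻¹ * (S.logMax z + S.C)
        + ((S.d : ℝ) ^ n)⁻¹ * S.logMax z := by unfold rate; ring
    have h8 : 0 ≤ ((S.d : ℝ) ^ n)⁻¹ * (S.logMax z + S.C) := by positivity
    rw [abs_le]
    constructor <;> linarith [mul_nonneg (inv_nonneg.2 (pow_nonneg hd.le n)) hz]

lemma dist_approx_succ_le (L : ℕ → M) (z : ℂ × ℂ) (n : ℕ) :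
    dist (S.approx L n z) (S.approx L (n + 1) z) ≤ S.rate z * (1 / 2) ^ n := by
  rw [dist_comm, Real.dist_eq]; exact S.abs_approx_succ_sub_le L n z

lemma tendsto_approx (L : ℕ → M) (z : ℂ × ℂ) :
    Tendsto (fun n => S.approx L n z) atTop (𝓝 (S.G L z)) :=
  (cauchySeq_of_le_geometric (1 / 2) (S.rate z) (by norm_num)
    (S.dist_approx_succ_le L z)).tendsto_limUnder

lemma abs_approx_sub_G_le (L : ℕ → M) (n : ℕ) (z : ℂ × ℂ) :
    |S.approx L n z - S.G L z| ≤ 2 * S.rate z * (1 / 2) ^ n := by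
  have := dist_le_of_le_geometric_of_tendsto (1 / 2) (S.rate z) (by norm_num)
    (S.dist_approx_succ_le L z) (S.tendsto_approx L z) n
  rw [Real.dist_eq] at this
  refine this.trans (le_of_eq ?_)
  ring

lemma G_nonneg (L : ℕ → M) (z : ℂ × ℂ) : 0 ≤ S.G L z :=
  ge_of_tendsto' (S.tendsto_approx L z) fun n => S.approx_nonneg L n z

lemma continuous_G : Continuous fun p : (ℕ → M) × (ℂ × ℂ) => S.G p.1 p.2 := by
  refine TendstoLocallyUniformly.continuous (F := fun n (p : (ℕ → M) × (ℂ × ℂ)) =>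
    S.approx p.1 n p.2) (p := atTop) ?_ (Eventually.frequently
      (Eventually.of_forall fun n => S.continuous_approx n))
  rw [Metric.tendstoLocallyUniformly_iff]
  intro ε hε p₀
  -- The rate depends on `z` alone and is locally bounded, which upgrades pointwise to locally
  -- uniform convergence.
  have h1 : ∀ᶠ p : (ℕ → M) × (ℂ × ℂ) in 𝓝 p₀, S.rate p.2 < S.rate p₀.2 + 1 :=
    (S.continuous_rate.comp continuous_snd).continuousAt.eventually
      (gt_mem_nhds (by simp))
  refine ⟨_, h1, ?_⟩
  have h2 : Tendsto (fun n : ℕ => 2 * (S.rate p₀.2 + 1) * (1 / 2 : ℝ) ^ n) atTop (𝓝 0) := by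
    simpa using (tendsto_pow_atTop_nhds_zero_of_lt_one (r := (1 / 2 : ℝ)) (by norm_num)
      (by norm_num)).const_mul (2 * (S.rate p₀.2 + 1))
  filter_upwards [h2.eventually (gt_mem_nhds hε)] with n hn p hp
  rw [dist_comm, Real.dist_eq]
  refine (S.abs_approx_sub_G_le p.1 n p.2).trans_lt (lt_of_le_of_lt ?_ hn)
  gcongr

lemma continuous_G_right (L : ℕ → M) : Continuous (S.G L) := by
  have h : Continuous fun z : ℂ × ℂ => ((L, z) : (ℕ → M) × (ℂ × ℂ)) :=
    continuous_const.prodMk continuous_id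
  have h2 := Continuous.comp S.continuous_G h
  exact h2

lemma G_comp_F (t : M) (L : ℕ → M) (z : ℂ × ℂ) :
    S.G L (S.F t z) = S.d * S.G (consSeq t L) z := by
  have h1 := (S.tendsto_approx (consSeq t L) z).comp (tendsto_add_atTop_nat 1)
  have h2 := h1.const_mul (S.d : ℝ)
  refine tendsto_nhds_unique (S.tendsto_approx L (S.F t z)) (h2.congr fun n => ?_)
  have := S.d_pos
  simp only [Function.comp_apply, approx]
  rw [iter_consSeq, pow_succ]
  field_simp

lemma G_eq_zero_of_forall_notMem {L : ℕ → M} {z : ℂ × ℂ}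
    (h : ∀ n, S.iter L n z ∉ escapeSet S.c S.R) : S.G L z = 0 := by
  have h2 : Tendsto (fun n : ℕ => (1 / 2 : ℝ) ^ n * S.logMax z) atTop (𝓝 0) := by
    simpa using (tendsto_pow_atTop_nhds_zero_of_lt_one (r := (1 / 2 : ℝ)) (by norm_num)
      (by norm_num)).mul_const (S.logMax z)
  refine le_antisymm (le_of_tendsto_of_tendsto' (S.tendsto_approx L z) h2 fun n => ?_)
    (S.G_nonneg L z)
  exact mul_le_mul (S.inv_pow_le n) (S.logMax_iter_le (h n)) (S.logMax_nonneg _) (by positivity)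

lemma mem_K_of_forall_notMem {L : ℕ → M} {z : ℂ × ℂ}
    (h : ∀ n, S.iter L n z ∉ escapeSet S.c S.R) : z ∈ S.K L := by
  change Bornology.IsBounded (Set.range fun n => S.iter L n z)
  refine isBounded_iff_forall_norm_le.2 ⟨max ‖z‖ S.R, ?_⟩
  rintro _ ⟨n, rfl⟩
  exact (le_max_left _ _).trans (S.max_norm_iter_le (h n))

lemma le_norm_c_iter {L : ℕ → M} {n : ℕ} {z : ℂ × ℂ} (h : S.iter L n z ∈ escapeSet S.c S.R)
    (k : ℕ) : 2 ^ k ≤ ‖S.c (S.iter L (n + k) z)‖ := by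
  induction k with
  | zero => simpa using S.one_le_R.trans h.2
  | succ k ih =>
    have h1 : 2 * ‖S.c (S.iter L (n + k) z)‖ ≤ ‖S.c (S.iter L (n + (k + 1)) z)‖ :=
      (S.henonLike (L (n + k))).two_mul_le _ (S.iter_mem h (Nat.le_add_right n k))
    rw [pow_succ]; linarith

lemma notMem_K_of_mem {L : ℕ → M} {n : ℕ} {z : ℂ × ℂ}
    (h : S.iter L n z ∈ escapeSet S.c S.R) : z ∉ S.K L := by
  intro hK
  change Bornology.IsBounded (Set.range fun n => S.iter L n z) at hK
  obtain ⟨B, hB⟩ := isBounded_iff_forall_norm_le.1 hK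
  obtain ⟨k, hk⟩ := pow_unbounded_of_one_lt B (one_lt_two)
  have h1 := hB _ ⟨n + k, rfl⟩
  have h2 := S.le_norm_c_iter h k
  have h3 := S.norm_c_le (S.iter L (n + k) z)
  simp only at h1
  linarith

/-- Wait until doubling has pushed `log ‖c‖` above `C`, at time `m`. From then on the approximants
move by at most `C / d ^ m` in total, too little to bring the limit down to zero. -/
lemma G_pos_of_mem {L : ℕ → M} {n : ℕ} {z : ℂ × ℂ}
    (h : S.iter L n z ∈ escapeSet S.c S.R) : 0 < S.G L z := by
  have hd := S.d_pos
  obtain ⟨k, hk⟩ := pow_unbounded_of_one_lt (Real.exp S.C) (one_lt_two)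
  set m := n + k with hm
  have hmem : ∀ j, S.iter L (m + j) z ∈ escapeSet S.c S.R := fun j => S.iter_mem h (by omega)
  have hlog : S.C < S.logMax (S.iter L m z) := by
    rw [S.logMax_of_mem (z := S.iter L m z) (hmem 0)]
    have h2 := hk.trans_le (S.le_norm_c_iter h k)
    exact (Real.lt_log_iff_exp_lt ((Real.exp_pos _).trans h2)).2 h2
  -- Keeping one factor `d⁻¹ ≤ 1 / 2` in the constant makes the geometric sum equal to `C / d ^ m`
  -- instead of twice that.
  have hstep : ∀ j, dist (S.approx L (m + j) z) (S.approx L (m + (j + 1)) z) ≤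
      (((S.d : ℝ) ^ m)⁻¹ * S.C / 2) * (1 / 2) ^ j := by
    intro j
    rw [dist_comm, Real.dist_eq]
    refine (S.abs_approx_succ_sub_le_of_mem (hmem j)).trans ?_
    have h1 := S.inv_pow_le (j + 1)
    have hC := S.C_nonneg
    calc _ = ((S.d : ℝ) ^ m)⁻¹ * S.C * ((S.d : ℝ) ^ (j + 1))⁻¹ := by
          rw [show m + j + 1 = m + (j + 1) by ring, pow_add, mul_inv]; ring
      _ ≤ ((S.d : ℝ) ^ m)⁻¹ * S.C * (1 / 2) ^ (j + 1) := by gcongr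
      _ = _ := by rw [pow_succ]; ring
  have hlim : Tendsto (fun j => S.approx L (m + j) z) atTop (𝓝 (S.G L z)) := by
    have := (S.tendsto_approx L z).comp (tendsto_add_atTop_nat m)
    refine this.congr fun j => ?_
    simp only [Function.comp_apply, add_comm]
  have h0 := dist_le_of_le_geometric_of_tendsto₀ (1 / 2) _ (by norm_num) hstep hlim
  rw [Real.dist_eq] at h0
  have h1 := (abs_le.1 h0).2
  have h2 : S.approx L (m + 0) z = ((S.d : ℝ) ^ m)⁻¹ * S.logMax (S.iter L m z) := rfl
  rw [h2] at h1
  have h3 : 0 < ((S.d : ℝ) ^ m)⁻¹ * (S.logMax (S.iter L m z) - S.C) :=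
    mul_pos (by positivity) (by linarith)
  have h4 : ((S.d : ℝ) ^ m)⁻¹ * S.C / 2 / (1 - 1 / 2) = ((S.d : ℝ) ^ m)⁻¹ * S.C := by ring
  rw [h4] at h1
  nlinarith

/-- An orbit either enters the escape region, where it is unbounded and `G` is positive, or never
does, where it is bounded and `G` is zero. -/
lemma mem_K_iff (L : ℕ → M) (z : ℂ × ℂ) : z ∈ S.K L ↔ S.G L z = 0 := by
  by_cases h : ∃ n, S.iter L n z ∈ escapeSet S.c S.R
  · obtain ⟨n, hn⟩ := h
    exact iff_of_false (S.notMem_K_of_mem hn) (S.G_pos_of_mem hn).ne'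
  · push Not at h
    exact iff_of_true (S.mem_K_of_forall_notMem h) (S.G_eq_zero_of_forall_notMem h)

lemma notMem_K_iff (L : ℕ → M) (z : ℂ × ℂ) :
    z ∉ S.K L ↔ ∃ n, S.iter L n z ∈ escapeSet S.c S.R := by
  constructor
  · intro h
    by_contra! hcon
    exact h (S.mem_K_of_forall_notMem hcon)
  · rintro ⟨n, hn⟩
    exact S.notMem_K_of_mem hn

lemma isClosed_K (L : ℕ → M) : IsClosed (S.K L) := by
  have : S.K L = S.G L ⁻¹' {0} := by ext z; exact S.mem_K_iff L z
  rw [this]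
  exact isClosed_singleton.preimage (S.continuous_G_right L)

/-- On compact subsets of the complement of `K`, orbits enter the escape region uniformly. -/
lemma exists_iter_mem_of_isCompact {L : ℕ → M} {T : Set (ℂ × ℂ)} (hT : IsCompact T)
    (h : T ⊆ (S.K L)ᶜ) : ∃ n, ∀ m ≥ n, ∀ z ∈ T, S.iter L m z ∈ escapeSet S.c S.R := by
  have hcover : T ⊆ ⋃ n, S.iter L n ⁻¹' interior (escapeSet S.c S.R) := by
    intro z hz
    obtain ⟨n, hn⟩ := (S.notMem_K_iff L z).1 (h hz)
    -- One extra iterate lands in the interior, giving an increasing open cover.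
    exact Set.mem_iUnion.2 ⟨n + 1, S.iter_mem_interior hn n.lt_succ_self⟩
  obtain ⟨n, hn⟩ := hT.elim_directed_cover _
    (fun n => isOpen_interior.preimage (S.contDiff_iter L n).continuous) hcover
    (directed_of_isDirected_le fun m n hmn z hz => by
      rcases hmn.eq_or_lt with rfl | hlt
      · exact hz
      · exact S.iter_mem_interior (interior_subset hz) hlt)
  exact ⟨n, fun m hm z hz => S.iter_mem (interior_subset (hn hz)) hm⟩

/-- The current of the Green function vanishes off `K`. -/
lemma ddcCurrent_G_eq_zero {L : ℕ → M} {φ : TwoForm} (hφ : IsTestForm φ)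
    (h : tsupport φ ⊆ (S.K L)ᶜ) : ddcCurrent (S.G L) φ = 0 := by
  obtain ⟨n₀, hn₀⟩ := S.exists_iter_mem_of_isCompact hφ.compact h
  -- On the support of `φ` the approximant is `d^{-n} log ‖c ∘ F_n‖` with `c ∘ F_n` entire and
  -- bounded away from zero. Dominated convergence then passes to `G`.
  have hzero : ∀ n ≥ n₀, ∫ z, (S.approx L n z : ℂ) * ddcCoeff φ z = 0 := by
    intro n hn
    have h1 := integral_log_norm_mul_ddcCoeff (f := fun z => S.c (S.iter L n z))
      (S.c.contDiff.comp (S.contDiff_iter L n)) hφ (fun z hz h0 => by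
        have := (hn₀ n hn z hz).2
        rw [h0, norm_zero] at this
        linarith [S.one_le_R])
    have h2 : ∀ z, (S.approx L n z : ℂ) * ddcCoeff φ z = (((S.d : ℝ) ^ n)⁻¹ : ℝ) *
        (((Real.log ‖S.c (S.iter L n z)‖ : ℝ) : ℂ) * ddcCoeff φ z) := by
      intro z
      by_cases hz : z ∈ tsupport φ
      · rw [approx, S.logMax_of_mem (hn₀ n hn z hz)]; push_cast; ring
      · rw [image_eq_zero_of_notMem_tsupport fun h => hz (tsupport_ddcCoeff_subset h)]; simp
    simp_rw [h2]
    rw [integral_const_mul, h1, mul_zero]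
  have hlim : Tendsto (fun n => ∫ z, (S.approx L n z : ℂ) * ddcCoeff φ z) atTop
      (𝓝 (∫ z, (S.G L z : ℂ) * ddcCoeff φ z)) := by
    have hcont := continuous_ddcCoeff hφ.smooth
    have hcs := hφ.hasCompactSupport_ddcCoeff
    refine tendsto_integral_of_dominated_convergence
      (fun z => (S.G L z + 2 * S.rate z) * ‖ddcCoeff φ z‖) (fun n => ?_) ?_ (fun n => ?_) ?_
    · have := (S.continuous_approx n).comp (Continuous.prodMk_right L)
      exact ((Complex.continuous_ofReal.comp this).mul hcont).aestronglyMeasurable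
    · have h1 := S.continuous_G_right L
      have h2 := S.continuous_rate
      exact Continuous.integrable_of_hasCompactSupport (by fun_prop) hcs.norm.mul_left
    · refine ae_of_all _ fun z => ?_
      rw [norm_mul, Complex.norm_real]
      gcongr
      have h1 := S.abs_approx_sub_G_le L n z
      have h2 : (1 / 2 : ℝ) ^ n ≤ 1 := pow_le_one₀ (by norm_num) (by norm_num)
      have h3 : 2 * S.rate z * (1 / 2) ^ n ≤ 2 * S.rate z :=
        mul_le_of_le_one_right (by linarith [S.rate_nonneg z]) h2
      rw [Real.norm_of_nonneg (S.approx_nonneg L n z)]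
      linarith [(abs_le.1 h1).2]
    · refine ae_of_all _ fun z => ?_
      exact ((Complex.continuous_ofReal.tendsto _).comp (S.tendsto_approx L z)).mul_const _
  have h0 := tendsto_nhds_unique hlim (tendsto_const_nhds.congr'
    ((eventually_ge_atTop n₀).mono fun n hn => (hzero n hn).symm))
  rw [ddcCurrent, h0, mul_zero]

lemma ddcCurrent_G_eq_zero_of_subset_K {L : ℕ → M} {φ : TwoForm} (h : tsupport φ ⊆ S.K L) :
    ddcCurrent (S.G L) φ = 0 := by
  have : ∀ z, (S.G L z : ℂ) * ddcCoeff φ z = 0 := by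
    intro z
    by_cases hz : z ∈ tsupport φ
    · rw [(S.mem_K_iff L z).1 (h hz)]; simp
    · rw [image_eq_zero_of_notMem_tsupport fun h => hz (tsupport_ddcCoeff_subset h)]; simp
  simp [ddcCurrent, this]

end EscapeSystem

/-! ### Mean value inequalities and supports -/

section Jensen

/-- Jensen's formula: the difference of the two sides is a sum over the zeros of `f` in the disc,
each contributing a nonnegative term. -/
lemma log_norm_le_circleAverage_log_norm {f : ℂ → ℂ} (hf : Differentiable ℂ f) {r : ℝ}
    (hr : 0 < r) (h0 : f 0 ≠ 0) :
    Real.log ‖f 0‖ ≤ Real.circleAverage (fun w => Real.log ‖f w‖) 0 r := by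
  have han : AnalyticOnNhd ℂ f (Metric.closedBall 0 |r|) := fun z _ => hf.analyticAt z
  rw [han.circleAverage_log_norm hr.ne' h0, le_add_iff_nonneg_left]
  refine finsum_nonneg fun u => ?_
  have hdiv : 0 ≤ MeromorphicOn.divisor f (Metric.closedBall 0 |r|) u :=
    MeromorphicOn.AnalyticOnNhd.divisor_nonneg han u
  by_cases hu : u ∈ Metric.closedBall (0 : ℂ) |r|
  · refine mul_nonneg (by exact_mod_cast hdiv) ?_
    -- At the centre the term is `log (r * 0⁻¹) = log 0 = 0`.
    rcases eq_or_ne u 0 with rfl | hne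
    · simp
    · refine Real.log_nonneg ?_
      rw [zero_sub, norm_neg, ← div_eq_mul_inv, one_le_div (norm_pos_iff.2 hne)]
      simpa [abs_of_pos hr] using hu
  · simp [Function.locallyFinsuppWithin.apply_eq_zero_of_notMem _ hu]

lemma log_norm_le_circleAverage {f : ℂ → ℂ} (hf : Differentiable ℂ f) {u : ℂ → ℝ}
    (hu : Continuous u) (h0 : ∀ w, 0 ≤ u w) (h : ∀ w, Real.log ‖f w‖ ≤ u w) {r : ℝ} (hr : 0 < r) :
    Real.log ‖f 0‖ ≤ Real.circleAverage u 0 r := by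
  -- With the convention `log 0 = 0`, a zero at the centre is handled by the nonnegativity of `u`.
  by_cases hf0 : f 0 = 0
  · rw [hf0, norm_zero, Real.log_zero]
    exact Real.circleAverage_nonneg_of_nonneg fun w _ => h0 w
  · refine (log_norm_le_circleAverage_log_norm hf hr hf0).trans ?_
    refine Real.circleAverage_mono ?_ hu.continuousOn.circleIntegrable' fun w _ => h w
    exact MeromorphicOn.circleIntegrable_log_norm fun z _ => (hf.analyticAt z).meromorphicAt

end Jensen

lemma Continuous.uncurry_slice {Y : Type*} [TopologicalSpace Y] {u : Y → ℂ × ℂ → ℝ}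
    (hu : Continuous fun p : Y × (ℂ × ℂ) => u p.1 p.2) (z : ℂ × ℂ) :
    Continuous fun y => u y z := by
  have h : Continuous fun y : Y => ((y, z) : Y × (ℂ × ℂ)) := continuous_id.prodMk continuous_const
  have := Continuous.comp hu h
  exact this

lemma continuous_circleAverage_line {Y : Type*} [TopologicalSpace Y] {u : Y → ℂ × ℂ → ℝ}
    (hu : Continuous fun p : Y × (ℂ × ℂ) => u p.1 p.2) (z v : ℂ × ℂ) (r : ℝ) :
    Continuous fun y => Real.circleAverage (fun w => u y (z + w • v)) 0 r := by
  simp only [Real.circleAverage_def, smul_eq_mul]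
  have hc : Continuous (circleMap 0 r) := continuous_circleMap 0 r
  have h : Continuous fun p : Y × ℝ => ((p.1, z + circleMap 0 r p.2 • v) : Y × (ℂ × ℂ)) := by
    fun_prop
  exact continuous_const.mul
    (intervalIntegral.continuous_parametric_intervalIntegral_of_continuous' (μ := volume)
      (f := fun y θ => u y (z + circleMap 0 r θ • v)) (Continuous.comp hu h) _ _)

/-- For a fixed disc, both sides of the mean value equality are continuous in the parameter, so
equality is a closed condition. -/
lemma mem_closure_meanEq {Y : Type*} [TopologicalSpace Y] {u : Y → ℂ × ℂ → ℝ}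
    (hu : Continuous fun p : Y × (ℂ × ℂ) => u p.1 p.2) (v : ℂ × ℂ) (U : Set (ℂ × ℂ)) {y₀ : Y}
    (h : ∃ᶠ y in 𝓝 y₀, MeanEq v (u y) U) : MeanEq v (u y₀) U := by
  intro z r hr hz
  have h1 := continuous_circleAverage_line hu z v r
  have h2 := Continuous.uncurry_slice hu z
  exact (isClosed_eq h1 h2).mem_of_frequently_of_tendsto
    (h.mono fun y hy => hy z r hr hz) tendsto_id

/-! ### Subharmonicity of the Green functions and the supports of their currents. -/

namespace EscapeSystem

variable {M : Type*} [TopologicalSpace M] (S : EscapeSystem M)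

lemma continuous_approx_right (L : ℕ → M) (n : ℕ) : Continuous (S.approx L n) :=
  continuous_const.mul (S.continuous_logMax.comp (S.contDiff_iter L n).continuous)

/-- `log max(‖X‖, R)` is the maximum of `log ‖f‖` for `f` the two coordinates and the constant `R`.
Jensen's inequality is applied to whichever one attains the maximum at the centre. -/
lemma approx_le_circleAverage (L : ℕ → M) (n : ℕ) (z v : ℂ × ℂ) {r : ℝ} (hr : 0 < r) :
    S.approx L n z ≤ Real.circleAverage (fun w => S.approx L n (z + w • v)) 0 r := by
  have hR := S.one_le_R
  have hit := S.contDiff_iter L n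
  set X : ℂ → ℂ × ℂ := fun w => S.iter L n (z + w • v) with hX
  have hXd : Differentiable ℂ X :=
    (hit.differentiable (by simp)).comp (by fun_prop : Differentiable ℂ fun w : ℂ => z + w • v)
  have hX0 : X 0 = S.iter L n z := by simp [hX]
  have hu : Continuous fun w => S.logMax (X w) := S.continuous_logMax.comp hXd.continuous
  have key : S.logMax (X 0) ≤ Real.circleAverage (fun w => S.logMax (X w)) 0 r := by
    have main : ∀ f : ℂ → ℂ, Differentiable ℂ f → (∀ w, ‖f w‖ ≤ max ‖X w‖ S.R) →
        S.logMax (X 0) = Real.log ‖f 0‖ →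
        S.logMax (X 0) ≤ Real.circleAverage (fun w => S.logMax (X w)) 0 r := by
      intro f hf hle heq
      rw [heq]
      refine log_norm_le_circleAverage hf hu (fun w => S.logMax_nonneg _) (fun w => ?_) hr
      rcases eq_or_ne (f w) 0 with h | h
      · rw [h, norm_zero, Real.log_zero]; exact S.logMax_nonneg _
      · exact Real.log_le_log (norm_pos_iff.2 h) (hle w)
    rcases le_total ‖X 0‖ S.R with h | h
    · refine main (fun _ => (S.R : ℂ)) (by fun_prop) (fun w => ?_) ?_
      · rw [Complex.norm_real, Real.norm_of_nonneg (by linarith)]; exact le_max_right _ _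
      · rw [Complex.norm_real, Real.norm_of_nonneg (by linarith), logMax, max_eq_right h]
    · rcases le_total ‖(X 0).1‖ ‖(X 0).2‖ with h' | h'
      · refine main (fun w => (X w).2) hXd.snd (fun w => (norm_snd_le _).trans (le_max_left _ _)) ?_
        rw [logMax, max_eq_left h, Prod.norm_def, max_eq_right h']
      · refine main (fun w => (X w).1) hXd.fst (fun w => (norm_fst_le _).trans (le_max_left _ _)) ?_
        rw [logMax, max_eq_left h, Prod.norm_def, max_eq_left h']
  have hfun : (fun w => S.approx L n (z + w • v)) =
      ((S.d : ℝ) ^ n)⁻¹ • fun w => S.logMax (X w) := rfl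
  rw [hfun, Real.circleAverage_smul, smul_eq_mul, approx, ← hX0]
  have := S.d_pos
  gcongr

lemma G_le_circleAverage (L : ℕ → M) (z v : ℂ × ℂ) {r : ℝ} (hr : 0 < r) :
    S.G L z ≤ Real.circleAverage (fun w => S.G L (z + w • v)) 0 r := by
  obtain ⟨B, hB⟩ := (isCompact_closedBall (0 : ℂ) r).exists_bound_of_continuousOn
    (f := fun w => S.rate (z + w • v)) (S.continuous_rate.comp (by fun_prop)).continuousOn
  have hline : Continuous fun w : ℂ => z + w • v := by fun_prop
  have hlim : Tendsto (fun n => Real.circleAverage (fun w => S.approx L n (z + w • v)) 0 r) atTop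
      (𝓝 (Real.circleAverage (fun w => S.G L (z + w • v)) 0 r)) := by
    rw [tendsto_iff_norm_sub_tendsto_zero]
    have h2 : Tendsto (fun n : ℕ => 2 * B * (1 / 2 : ℝ) ^ n) atTop (𝓝 0) := by
      simpa using (tendsto_pow_atTop_nhds_zero_of_lt_one (r := (1 / 2 : ℝ)) (by norm_num)
        (by norm_num)).const_mul (2 * B)
    refine squeeze_zero (fun _ => norm_nonneg _) (fun n => ?_) h2
    refine norm_circleAverage_sub_le ((S.continuous_approx_right L n).comp hline)
      ((S.continuous_G_right L).comp hline) hr.le fun w hw => ?_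
    refine (S.abs_approx_sub_G_le L n _).trans ?_
    gcongr
    exact (le_abs_self _).trans (hB w hw)
  exact le_of_tendsto_of_tendsto' (S.tendsto_approx L z) hlim
    fun n => S.approx_le_circleAverage L n z v hr

/-- The boundary of `K` is not in the interior of the locus where `G` satisfies the mean value
equality. -/
lemma notMem_frontier_of_meanEq {L : ℕ → M} {U : Set (ℂ × ℂ)} (hU : IsOpen U)
    (h1 : MeanEq (1, 0) (S.G L) U) (h2 : MeanEq (0, 1) (S.G L) U) {z : ℂ × ℂ} (hzU : z ∈ U) :
    z ∉ frontier (S.K L) := by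
  intro hz
  have hzK : z ∈ S.K L := (S.isClosed_K L).frontier_subset hz
  have h := eventually_eq_zero_of_meanEq hU h1 h2 (S.continuous_G_right L) (S.G_nonneg L) hzU
    ((S.mem_K_iff L z).1 hzK)
  exact hz.2 (mem_interior_iff_mem_nhds.2 (h.mono fun w hw => (S.mem_K_iff L w).2 hw))

/-- A connected set missing the boundary lies wholly in the interior of `K` or wholly in its
complement. Working on balls therefore avoids cutting `φ` up with a partition of unity. -/
lemma ddcCurrent_G_eq_zero_of_disjoint {L : ℕ → M} {B : Set (ℂ × ℂ)} (hB : IsPreconnected B)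
    (hdisj : Disjoint B (frontier (S.K L))) {φ : TwoForm} (hφ : IsTestForm φ)
    (h : tsupport φ ⊆ B) : ddcCurrent (S.G L) φ = 0 := by
  have hK := S.isClosed_K L
  have hcover : B ⊆ interior (S.K L) ∪ (S.K L)ᶜ := by
    intro z hz
    by_cases hz' : z ∈ S.K L
    · left
      by_contra hcon
      exact Set.disjoint_left.1 hdisj hz (by rw [hK.frontier_eq]; exact ⟨hz', hcon⟩)
    · exact Or.inr hz'
  rcases hB.subset_or_subset isOpen_interior hK.isOpen_compl
    (disjoint_compl_right.mono_left interior_subset) hcover with h1 | h1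
  · exact S.ddcCurrent_G_eq_zero_of_subset_K (h.trans (h1.trans interior_subset))
  · exact S.ddcCurrent_G_eq_zero hφ (h.trans h1)

theorem currentSupport_G (L : ℕ → M) :
    currentSupport (ddcCurrent (S.G L)) = frontier (S.K L) := by
  have hK := S.isClosed_K L
  ext z
  constructor
  · intro h
    by_contra hz
    obtain ⟨r, hr, hrU⟩ := Metric.isOpen_iff.1 (isClosed_frontier (s := S.K L)).isOpen_compl z hz
    obtain ⟨φ, hφ, hsub, hne⟩ := h _ Metric.isOpen_ball (Metric.mem_ball_self hr)
    exact hne (S.ddcCurrent_G_eq_zero_of_disjoint (convex_ball z r).isPreconnected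
      (Set.disjoint_left.2 fun w hw => hrU hw) hφ hsub)
  · intro hz U hU hzU
    by_contra! hcon
    obtain ⟨h1, h2⟩ := meanEq_of_ddcCurrent_eq_zero (S.continuous_G_right L) hU hcon
    exact S.notMem_frontier_of_meanEq hU h1 h2 hzU hz

/-- If `frontier (S.K L)` misses a ball for `L` arbitrarily close to `L₀`, the mean value equalities
there pass to `L₀`, and the centre cannot be a boundary point. -/
theorem lowerHemicontinuous_frontier_K :
    LowerHemicontinuous fun L : ℕ → M => frontier (S.K L) := by
  refine lowerHemicontinuous_iff.2 fun L₀ => lowerHemicontinuousAt_iff.2 ?_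
  rintro U hU ⟨z, hz, hzU⟩
  by_contra hcon
  rw [not_eventually] at hcon
  obtain ⟨r, hr, hrU⟩ := Metric.isOpen_iff.1 hU z hzU
  have hmean : ∃ᶠ L in 𝓝 L₀, MeanEq (1, 0) (S.G L) (Metric.ball z r) ∧
      MeanEq (0, 1) (S.G L) (Metric.ball z r) := by
    refine hcon.mono fun L hL => ?_
    refine meanEq_of_ddcCurrent_eq_zero (S.continuous_G_right L) Metric.isOpen_ball
      fun φ hφ hsub => S.ddcCurrent_G_eq_zero_of_disjoint (convex_ball z r).isPreconnected
        (Set.disjoint_left.2 fun w hw hw' => hL ⟨w, hw', hrU hw⟩) hφ hsub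
  exact S.notMem_frontier_of_meanEq Metric.isOpen_ball
    (mem_closure_meanEq S.continuous_G _ _ (hmean.mono fun _ h => h.1))
    (mem_closure_meanEq S.continuous_G _ _ (hmean.mono fun _ h => h.2)) (Metric.mem_ball_self hr) hz

end EscapeSystem

/-! ### Averages of currents -/

section Average

variable {Y : Type*} [TopologicalSpace Y] [CompactSpace Y] [T2Space Y] [MeasurableSpace Y] [BorelSpace Y]
  [SecondCountableTopology Y] (ν : Measure Y) [IsFiniteMeasure ν] {u : Y → ℂ × ℂ → ℝ}

lemma integrable_of_continuous_compactSpace {E : Type*} [NormedAddCommGroup E]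
    [SecondCountableTopologyEither Y E] {f : Y → E}
    (hf : Continuous f) : Integrable f ν :=
  hf.integrable_of_hasCompactSupport (HasCompactSupport.of_compactSpace f)

lemma continuous_integral_param (hu : Continuous fun p : Y × (ℂ × ℂ) => u p.1 p.2) :
    Continuous fun z => ∫ y, u y z ∂ν := by
  have h := continuous_parametric_integral_of_continuous (μ := ν)
    (f := fun (z : ℂ × ℂ) (y : Y) => u y z)
    (hu.comp (continuous_snd.prodMk continuous_fst)) isCompact_univ
  simpa using h

lemma ddcCurrent_integral (hu : Continuous fun p : Y × (ℂ × ℂ) => u p.1 p.2) {φ : TwoForm}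
    (hφ : IsTestForm φ) :
    Integrable (fun y => ddcCurrent (u y) φ) ν ∧
      ddcCurrent (fun z => ∫ y, u y z ∂ν) φ = ∫ y, ddcCurrent (u y) φ ∂ν := by
  have hd := continuous_ddcCoeff hφ.smooth
  have hcs := hφ.hasCompactSupport_ddcCoeff
  have hint : Integrable (fun p : Y × (ℂ × ℂ) => (u p.1 p.2 : ℂ) * ddcCoeff φ p.2)
      (ν.prod volume) := by
    refine Continuous.integrable_of_hasCompactSupport
      ((Complex.continuous_ofReal.comp hu).mul (hd.comp continuous_snd)) ?_
    refine HasCompactSupport.intro (isCompact_univ.prod hcs) (K := Set.univ ×ˢ tsupport (ddcCoeff φ))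
      fun p hp => ?_
    have : p.2 ∉ tsupport (ddcCoeff φ) := fun h => hp ⟨Set.mem_univ _, h⟩
    rw [image_eq_zero_of_notMem_tsupport this, mul_zero]
  constructor
  · exact hint.integral_prod_left.const_mul _
  · simp only [ddcCurrent]
    rw [integral_const_mul, integral_integral_swap hint]
    congr 1
    refine integral_congr_ae (ae_of_all _ fun z => ?_)
    simp only
    rw [integral_mul_const, integral_complex_ofReal]

lemma circleAverage_integral (hu : Continuous fun p : Y × (ℂ × ℂ) => u p.1 p.2) (z v : ℂ × ℂ)
    (r : ℝ) :
    Real.circleAverage (fun w => ∫ y, u y (z + w • v) ∂ν) 0 r =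
      ∫ y, Real.circleAverage (fun w => u y (z + w • v)) 0 r ∂ν := by
  have hc : Continuous (circleMap 0 r) := continuous_circleMap 0 r
  have hcont : Continuous fun p : ℝ × Y => u p.2 (z + circleMap 0 r p.1 • v) := by
    have h : Continuous fun p : ℝ × Y => ((p.2, z + circleMap 0 r p.1 • v) : Y × (ℂ × ℂ)) := by
      fun_prop
    have := Continuous.comp hu h
    exact this
  simp only [Real.circleAverage_def, smul_eq_mul]
  rw [integral_const_mul, MeasureTheory.intervalIntegral_integral_swap]
  have hprod : (volume.restrict (Set.uIoc 0 (2 * Real.pi))).prod ν =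
      (volume.prod ν).restrict (Set.uIoc 0 (2 * Real.pi) ×ˢ Set.univ) := by
    rw [← Measure.prod_restrict, Measure.restrict_univ]
  rw [hprod]
  refine IntegrableOn.mono_set (t := Set.uIcc 0 (2 * Real.pi) ×ˢ Set.univ) ?_
    (Set.prod_mono_left Set.uIoc_subset_uIcc)
  exact hcont.continuousOn.integrableOn_compact (isCompact_uIcc.prod isCompact_univ)

/-- If an average of functions satisfying the mean value inequality satisfies the mean value
equality, then so does every member of the family. -/
lemma MeanEq.of_integral [ν.IsOpenPosMeasure] (hu : Continuous fun p : Y × (ℂ × ℂ) => u p.1 p.2)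
    {v : ℂ × ℂ} {U : Set (ℂ × ℂ)}
    (hsub : ∀ y z r, 0 < r → u y z ≤ Real.circleAverage (fun w => u y (z + w • v)) 0 r)
    (h : MeanEq v (fun z => ∫ y, u y z ∂ν) U) (y : Y) : MeanEq v (u y) U := by
  intro z r hr hz
  have hc1 := continuous_circleAverage_line hu z v r
  have hc2 := Continuous.uncurry_slice hu z
  have h1 := h z r hr hz
  rw [circleAverage_integral ν hu] at h1
  -- The defect in the mean value inequality is nonnegative and continuous in `y` with zero
  -- integral, so it vanishes for every `y`, not just almost every.
  have hzero : ∫ y, (Real.circleAverage (fun w => u y (z + w • v)) 0 r - u y z) ∂ν = 0 := by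
    rw [integral_sub (integrable_of_continuous_compactSpace ν hc1)
      (integrable_of_continuous_compactSpace ν hc2), h1, sub_self]
  have hae := (integral_eq_zero_iff_of_nonneg (fun y => sub_nonneg.2 (hsub y z r hr))
    (integrable_of_continuous_compactSpace ν (hc1.sub hc2))).1 hzero
  have heq := (Continuous.ae_eq_iff_eq ν (hc1.sub hc2) continuous_const).1 hae
  exact sub_eq_zero.1 (congrFun heq y)

end Average

/-! ### Infinite product measures -/

section InfiniteProduct

variable {M : Type*} [MeasurableSpace M] (m : Measure M) [IsProbabilityMeasure m]

lemma isOpenPosMeasure_infinitePi [TopologicalSpace M] [OpensMeasurableSpace M]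
    [m.IsOpenPosMeasure] : (Measure.infinitePi fun _ : ℕ => m).IsOpenPosMeasure where
  open_pos U hU := by
    rintro ⟨L, hL⟩ h0
    obtain ⟨I, u, hu, hsub⟩ := isOpen_pi_iff.1 hU L hL
    have h1 := measure_mono_null hsub h0
    rw [Measure.infinitePi_pi _ fun i hi => (hu i hi).1.measurableSet, Finset.prod_eq_zero_iff] at h1
    obtain ⟨i, hi, h2⟩ := h1
    exact (hu i hi).1.measure_ne_zero m ⟨L i, (hu i hi).2⟩ h2

lemma measurable_consSeq : Measurable fun p : M × (ℕ → M) => consSeq p.1 p.2 := by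
  refine measurable_pi_lambda _ fun n => ?_
  cases n with
  | zero => exact measurable_fst
  | succ n => exact (measurable_pi_apply n).comp measurable_snd

/-- A product measure is determined by its values on finite boxes, and prepending a letter only
shifts the coordinates of a box by one. -/
lemma map_consSeq_prod_infinitePi :
    (m.prod (Measure.infinitePi fun _ : ℕ => m)).map (fun p => consSeq p.1 p.2) =
      Measure.infinitePi fun _ : ℕ => m := by
  refine Measure.eq_infinitePi _ fun s t ht => ?_
  rw [Measure.map_apply measurable_consSeq (MeasurableSet.pi s.countable_toSet fun i _ => ht i)]
  set s' : Finset ℕ := s.preimage Nat.succ Nat.succ_injective.injOn with hs'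
  -- The first factor is an implication because the box may leave coordinate `0` unconstrained.
  have hpre : (fun p : M × (ℕ → M) => consSeq p.1 p.2) ⁻¹' Set.pi s t =
      {x | 0 ∈ s → x ∈ t 0} ×ˢ Set.pi (s' : Set ℕ) fun n => t (n + 1) := by
    ext p
    simp only [Set.mem_preimage, Set.mem_pi, Finset.mem_coe, Set.mem_prod, Set.mem_ofPred_eq]
    constructor
    · exact fun h => ⟨fun h0 => h 0 h0, fun n hn => h (n + 1) (by simpa [hs'] using hn)⟩
    · rintro ⟨h0, h1⟩ n hn
      cases n with
      | zero => exact h0 hn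
      | succ n => exact h1 n (by simpa [hs'] using hn)
  rw [hpre, Measure.prod_prod, Measure.infinitePi_pi _ fun i _ => ht (i + 1)]
  by_cases h0 : 0 ∈ s
  · have hs : s = insert 0 (s'.map ⟨Nat.succ, Nat.succ_injective⟩) := by
      ext n; cases n <;> simp [hs', h0]
    conv_rhs => rw [hs, Finset.prod_insert (by simp), Finset.prod_map]
    simp [h0]
  · have hs : s = s'.map ⟨Nat.succ, Nat.succ_injective⟩ := by
      ext n; cases n <;> simp [hs', h0]
    conv_rhs => rw [hs, Finset.prod_map]
    simp [h0]

lemma integral_consSeq {f : (ℕ → M) → ℝ}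
    (hf : Integrable f (Measure.infinitePi fun _ : ℕ => m)) :
    Integrable (fun p : M × (ℕ → M) => f (consSeq p.1 p.2))
      (m.prod (Measure.infinitePi fun _ : ℕ => m)) ∧
    ∫ t, ∫ L, f (consSeq t L) ∂(Measure.infinitePi fun _ : ℕ => m) ∂m =
      ∫ L, f L ∂(Measure.infinitePi fun _ : ℕ => m) := by
  rw [← map_consSeq_prod_infinitePi m] at hf
  have h1 : Integrable (fun p : M × (ℕ → M) => f (consSeq p.1 p.2))
      (m.prod (Measure.infinitePi fun _ : ℕ => m)) :=
    (integrable_map_measure hf.aestronglyMeasurable measurable_consSeq.aemeasurable).1 hf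
  refine ⟨h1, ?_⟩
  rw [integral_integral h1, ← integral_map measurable_consSeq.aemeasurable hf.aestronglyMeasurable,
    map_consSeq_prod_infinitePi m]

end InfiniteProduct

/-! ### Families of Hénon maps are escape systems -/

lemma HenonLike.mono {c : ℂ × ℂ → ℂ} {R C C' : ℝ} {d : ℕ} {F : ℂ × ℂ → ℂ × ℂ}
    (h : HenonLike c R d C F) (hC : C ≤ C') : HenonLike c R d C' F where
  mem_interior := h.mem_interior
  two_mul_le := h.two_mul_le
  abs_log_sub_le z hz := (h.abs_log_sub_le z hz).trans hC
  of_notMem := h.of_notMem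
  log_le z := (h.log_le z).trans (by gcongr)

/-- The list must be nonempty because the identity does not satisfy the doubling bound of
`HenonLike` in general. -/
lemma exists_henonLike_list_prod {ι M : Type*} {c : ℂ × ℂ → ℂ} {R : ℝ}
    {e : ι → M → Equiv.Perm (ℂ × ℂ)} {deg : ι → ℕ}
    (h : ∀ j, ∃ C, ∀ t, HenonLike c R (deg j) C (e j t)) {l : List ι} (hl : l ≠ []) :
    ∃ C, ∀ t, HenonLike c R (l.map deg).prod C (l.map fun j => e j t).prod := by
  induction l with
  | nil => exact absurd rfl hl
  | cons j l ih =>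
    rcases eq_or_ne l [] with rfl | hne
    · simpa using h j
    · obtain ⟨C₁, h₁⟩ := ih hne
      obtain ⟨C₂, h₂⟩ := h j
      exact ⟨_, fun t => by simpa using! (h₂ t).comp (h₁ t)⟩

lemma continuous_equivPerm_list_prod {ι M : Type*} [TopologicalSpace M] {e : ι → M → Equiv.Perm (ℂ × ℂ)}
    (h : ∀ j, Continuous fun p : M × (ℂ × ℂ) => e j p.1 p.2) (l : List ι) :
    Continuous fun p : M × (ℂ × ℂ) => (l.map fun j => e j p.1).prod p.2 := by
  induction l with
  | nil => exact continuous_snd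
  | cons j l ih =>
    have := (h j).comp (continuous_fst.prodMk ih)
    exact this

lemma contDiff_list_prod {ι : Type*} {e : ι → Equiv.Perm (ℂ × ℂ)}
    (h : ∀ j, ContDiff ℂ ∞ (e j)) (l : List ι) : ContDiff ℂ ∞ (l.map e).prod := by
  induction l with
  | nil => exact contDiff_id
  | cons j l ih =>
    have := (h j).comp ih
    simpa using! this

namespace HenonFamily

variable {M : Type*} [TopologicalSpace M] (A : HenonFamily M)

/-- The factors of `H_t` or of its inverse. -/
noncomputable def factor (ε : ℤˣ) (j : Fin A.r) (t : M) : Equiv.Perm (ℂ × ℂ) :=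
  henonMap (A.p j t) (A.a j t) (A.a_ne_zero j t) ^ (ε : ℤ)

lemma factor_one_apply (j : Fin A.r) (t : M) (z : ℂ × ℂ) :
    A.factor 1 j t z = (z.2, (A.p j t).eval z.2 - A.a j t * z.1) := by
  simp [factor, henonMap]

lemma factor_neg_one_apply (j : Fin A.r) (t : M) (z : ℂ × ℂ) :
    A.factor (-1) j t z = (((A.p j t).eval z.1 - z.2) / A.a j t, z.1) := by
  simp only [factor, Units.val_neg, Units.val_one, zpow_neg, zpow_one]
  rfl

lemma ne_nil_finRange : List.finRange A.r ≠ [] := by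
  have := A.r_pos
  intro h
  have h1 := congrArg List.length h
  simp at h1
  omega

/-- Inversion reverses the order of the factors. Presenting both signs as a product over some list
lets all later arguments treat them together. -/
lemma exists_list_prod (ε : ℤˣ) : ∃ l : List (Fin A.r), l ≠ [] ∧ (l.map A.deg).prod = A.d ∧
    ∀ t, A.H t ^ (ε : ℤ) = (l.map fun j => A.factor ε j t).prod := by
  have hd : ((List.finRange A.r).map A.deg).prod = A.d := by
    rw [← List.ofFn_eq_map, List.prod_ofFn]; rfl
  rcases Int.units_eq_one_or ε with rfl | rfl
  · refine ⟨(List.finRange A.r).reverse, by simpa using A.ne_nil_finRange, ?_, fun t => ?_⟩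
    · rw [List.map_reverse, List.prod_reverse, hd]
    · rw [List.map_reverse, ← List.ofFn_eq_map]
      simp [H, factor]
  · refine ⟨List.finRange A.r, A.ne_nil_finRange, hd, fun t => ?_⟩
    rw [← List.ofFn_eq_map]
    simp [H, factor, List.prod_inv_reverse, List.map_ofFn, Function.comp_def]

lemma continuous_eval (j : Fin A.r) {X : Type*} [TopologicalSpace X] {f : X → M} {g : X → ℂ}
    (hf : Continuous f) (hg : Continuous g) : Continuous fun x => (A.p j (f x)).eval (g x) := by
  simp only [Polynomial.eval_eq_sum_range, A.natDegree_eq]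
  exact continuous_finsetSum _ fun i _ => ((A.continuous_coeff j i).comp hf).mul (hg.pow i)

lemma continuous_factor (ε : ℤˣ) (j : Fin A.r) :
    Continuous fun p : M × (ℂ × ℂ) => A.factor ε j p.1 p.2 := by
  have ha := A.continuous_a j
  rcases Int.units_eq_one_or ε with rfl | rfl
  · simp only [factor_one_apply]
    have := A.continuous_eval j (f := fun p : M × (ℂ × ℂ) => p.1) (g := fun p => p.2.2)
      (by fun_prop) (by fun_prop)
    fun_prop
  · simp only [factor_neg_one_apply]
    have := A.continuous_eval j (f := fun p : M × (ℂ × ℂ) => p.1) (g := fun p => p.2.1)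
      (by fun_prop) (by fun_prop)
    have ha' : Continuous fun p : M × (ℂ × ℂ) => A.a j p.1 := by fun_prop
    exact ((this.sub (by fun_prop)).div ha' fun p => A.a_ne_zero j p.1).prodMk (by fun_prop)

lemma contDiff_factor (ε : ℤˣ) (j : Fin A.r) (t : M) : ContDiff ℂ ∞ (A.factor ε j t) := by
  have hp : ∀ g : ℂ × ℂ → ℂ, ContDiff ℂ ∞ g → ContDiff ℂ ∞ fun z => (A.p j t).eval (g z) := by
    intro g hg
    have := ((A.p j t).contDiff_aeval (𝕜 := ℂ) (R := ℂ) ∞).comp hg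
    simpa using! this
  rcases Int.units_eq_one_or ε with rfl | rfl
  · rw [show ⇑(A.factor 1 j t) = _ from funext (A.factor_one_apply j t)]
    have := hp _ contDiff_snd
    fun_prop
  · rw [show ⇑(A.factor (-1) j t) = _ from funext (A.factor_neg_one_apply j t)]
    have := hp _ contDiff_fst
    exact ((this.sub contDiff_snd).div_const _).prodMk contDiff_fst

lemma contDiff_H (ε : ℤˣ) (t : M) : ContDiff ℂ ∞ ⇑(A.H t ^ (ε : ℤ)) := by
  obtain ⟨l, -, -, hl⟩ := A.exists_list_prod ε
  rw [hl t]
  exact contDiff_list_prod (fun j => A.contDiff_factor ε j t) l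

lemma contDiff_H_inv (ε : ℤˣ) (t : M) : ContDiff ℂ ∞ ⇑((A.H t ^ (ε : ℤ))⁻¹ : Equiv.Perm (ℂ × ℂ)) := by
  have := A.contDiff_H (-ε) t
  rwa [Units.val_neg, zpow_neg] at this

lemma continuous_H (ε : ℤˣ) :
    Continuous fun p : M × (ℂ × ℂ) => (A.H p.1 ^ (ε : ℤ)) p.2 := by
  obtain ⟨l, -, -, hl⟩ := A.exists_list_prod ε
  simp only [hl]
  exact continuous_equivPerm_list_prod (A.continuous_factor ε) l

lemma two_le_d : 2 ≤ A.d := by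
  have h1 : A.deg ⟨0, A.r_pos⟩ ≤ A.d :=
    Finset.single_le_prod' (fun j _ => (by have := A.two_le_deg j; omega : 1 ≤ A.deg j))
      (Finset.mem_univ _)
  exact (A.two_le_deg _).trans h1

lemma iter_eq {ε : ℤˣ} {S : EscapeSystem M} (hF : ∀ t, S.F t = ⇑(A.H t ^ (ε : ℤ)))
    (L : ℕ → M) (n : ℕ) (z : ℂ × ℂ) : A.iter ε L n z = S.iter L n z := by
  induction n with
  | zero => rfl
  | succ n ih => rw [iter, EscapeSystem.iter, hF, ih]

variable [CompactSpace M] [Nonempty M]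

lemma exists_eventually_henonLike (ε : ℤˣ) : ∃ c : (ℂ × ℂ) →L[ℂ] ℂ, (∀ z, ‖c z‖ ≤ ‖z‖) ∧
    ∀ᶠ R in atTop, ∀ j, ∃ C, ∀ t, HenonLike c R (A.deg j) C (A.factor ε j t) := by
  rcases Int.units_eq_one_or ε with rfl | rfl
  · refine ⟨ContinuousLinearMap.snd ℂ ℂ ℂ, norm_snd_le, eventually_all.2 fun j => ?_⟩
    refine eventually_henonLike (c' := Prod.fst) (ContinuousLinearMap.continuous _) continuous_fst
      (fun z => by rw [max_comm]; rfl) (A.two_le_deg j) (A.natDegree_eq j) (A.continuous_coeff j)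
      (A.continuous_a j) (fun t z => ?_) fun t z => ?_
    · rw [factor_one_apply]; rfl
    · rw [factor_one_apply]; rfl
  · refine ⟨ContinuousLinearMap.fst ℂ ℂ ℂ, norm_fst_le, eventually_all.2 fun j => ?_⟩
    refine eventually_henonLike (c' := Prod.snd)
      (q := fun t => Polynomial.C (A.a j t)⁻¹ * A.p j t) (b := fun t => (A.a j t)⁻¹)
      (ContinuousLinearMap.continuous _) continuous_snd (fun z => rfl) (A.two_le_deg j)
      (fun t => ?_) (fun i => ?_) ((A.continuous_a j).inv₀ (A.a_ne_zero j)) (fun t z => ?_)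
      fun t z => ?_
    · rw [Polynomial.natDegree_C_mul (inv_ne_zero (A.a_ne_zero j t)), A.natDegree_eq]
    · simp only [Polynomial.coeff_C_mul]
      exact ((A.continuous_a j).inv₀ (A.a_ne_zero j)).mul (A.continuous_coeff j i)
    · rw [factor_neg_one_apply]; rfl
    · rw [factor_neg_one_apply]
      simp
      ring

/-- The escape system of a compact family of Hénon maps. -/
lemma exists_escapeSystem (ε : ℤˣ) :
    ∃ S : EscapeSystem M, S.d = A.d ∧ ∀ t, S.F t = ⇑(A.H t ^ (ε : ℤ)) := by
  obtain ⟨l, hne, hd, hl⟩ := A.exists_list_prod ε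
  obtain ⟨c, hc, hev⟩ := A.exists_eventually_henonLike ε
  obtain ⟨R, hR, hR1⟩ := (hev.and (eventually_ge_atTop 1)).exists
  obtain ⟨C, hC⟩ := exists_henonLike_list_prod hR hne
  exact ⟨{  F := fun t => ⇑(A.H t ^ (ε : ℤ))
            c := c
            R := R
            C := max C 0
            d := A.d
            one_le_R := hR1
            C_nonneg := le_max_right _ _
            two_le_d := A.two_le_d
            norm_c_le := hc
            henonLike := fun t => by
              rw [hl t, ← hd]
              exact (hC t).mono (le_max_left _ _)
            continuous_F := A.continuous_H ε
            contDiff_F := A.contDiff_H ε }, rfl, fun t => rfl⟩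

end HenonFamily

/-- Euclidean and sup norms differ by a factor of at most `2`, and truncating at `1` or at `R` costs
at most `log R`. This bounded error disappears after division by `d ^ n`. -/
lemma EscapeSystem.abs_posLog_sub_logMax_le {M : Type*} [TopologicalSpace M] (S : EscapeSystem M)
    (z : ℂ × ℂ) :
    |Real.posLog (Real.sqrt (‖z.1‖ ^ 2 + ‖z.2‖ ^ 2)) - S.logMax z| ≤ Real.log 2 + Real.log S.R := by
  have hR := S.one_le_R
  set N := Real.sqrt (‖z.1‖ ^ 2 + ‖z.2‖ ^ 2) with hN
  have hN0 : 0 ≤ N := Real.sqrt_nonneg _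
  have h1 : ‖z‖ ≤ N := by
    refine max_le (Real.le_sqrt_of_sq_le ?_) (Real.le_sqrt_of_sq_le ?_)
    · have := sq_nonneg ‖z.2‖; linarith
    · have := sq_nonneg ‖z.1‖; linarith
  have h2 : N ≤ 2 * ‖z‖ := by
    refine Real.sqrt_le_iff.2 ⟨by positivity, ?_⟩
    have a := norm_fst_le z
    have b := norm_snd_le z
    nlinarith [norm_nonneg z.1, norm_nonneg z.2]
  have hm := S.max_pos z
  rw [Real.posLog_eq_log_max_one hN0, logMax]
  have hlR := Real.log_nonneg hR
  have hl2 := Real.log_nonneg one_le_two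
  have e1 : Real.log (max 1 N) ≤ Real.log 2 + Real.log (max ‖z‖ S.R) := by
    rw [← Real.log_mul (by norm_num) (by linarith)]
    refine Real.log_le_log (lt_of_lt_of_le one_pos (le_max_left _ _)) (max_le (by linarith) ?_)
    have := le_max_left ‖z‖ S.R
    linarith
  have e2 : Real.log (max ‖z‖ S.R) ≤ Real.log S.R + Real.log (max 1 N) := by
    have h3 : 1 ≤ max 1 N := le_max_left _ _
    rw [← Real.log_mul (by linarith) (by linarith)]
    refine Real.log_le_log (by linarith) (max_le ?_ ?_)
    · have := le_max_right 1 N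
      nlinarith
    · exact le_mul_of_one_le_right (by linarith) h3
  rw [abs_le]
  constructor <;> linarith

/-! ### Identification of the Hénon Green functions with those of the escape system. -/

namespace HenonFamily

variable {M : Type*} [TopologicalSpace M] (A : HenonFamily M)

lemma tendsto_greenApprox {ε : ℤˣ} {S : EscapeSystem M} (hd : S.d = A.d)
    (hF : ∀ t, S.F t = ⇑(A.H t ^ (ε : ℤ))) (L : ℕ → M) (z : ℂ × ℂ) :
    Tendsto (fun n => A.greenApprox ε L n z) atTop (𝓝 (S.G L z)) := by
  have h0 : Tendsto (fun n => A.greenApprox ε L n z - S.approx L n z) atTop (𝓝 0) := by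
    have h2 : Tendsto (fun n : ℕ => (1 / 2 : ℝ) ^ n * (Real.log 2 + Real.log S.R)) atTop (𝓝 0) := by
      simpa using (tendsto_pow_atTop_nhds_zero_of_lt_one (r := (1 / 2 : ℝ)) (by norm_num)
        (by norm_num)).mul_const (Real.log 2 + Real.log S.R)
    refine squeeze_zero_norm (fun n => ?_) h2
    have h3 := S.abs_posLog_sub_logMax_le (S.iter L n z)
    have h4 := S.inv_pow_le n
    have hd' := S.d_pos
    rw [greenApprox, EscapeSystem.approx, A.iter_eq hF, ← hd, one_div, ← mul_sub, norm_mul,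
      Real.norm_of_nonneg (by positivity), Real.norm_eq_abs]
    gcongr
  simpa using h0.add (S.tendsto_approx L z)

lemma green_eq {ε : ℤˣ} {S : EscapeSystem M} (hd : S.d = A.d)
    (hF : ∀ t, S.F t = ⇑(A.H t ^ (ε : ℤ))) (L : ℕ → M) : A.green ε L = S.G L :=
  funext fun z => (A.tendsto_greenApprox hd hF L z).limUnder_eq

lemma K_eq {ε : ℤˣ} {S : EscapeSystem M} (hF : ∀ t, S.F t = ⇑(A.H t ^ (ε : ℤ))) (L : ℕ → M) :
    A.K ε L = S.K L := by
  simp only [K, EscapeSystem.K, A.iter_eq hF]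

end HenonFamily

/-! ### The main theorem. -/

lemma ddcCurrent_const_mul (a : ℝ) (u : ℂ × ℂ → ℝ) (φ : TwoForm) :
    ddcCurrent (fun z => a * u z) φ = a * ddcCurrent u φ := by
  simp only [ddcCurrent, Complex.ofReal_mul, mul_assoc]
  rw [integral_const_mul]
  ring

theorem proposition1p3 {k : ℕ} {M : Set (Fin k → ℂ)} (hM : IsCompact M)
    (A : HenonFamily M) (m : Measure M) [IsProbabilityMeasure m] (ε : ℤˣ) :
    (∀ (L : ℕ → M) (z : ℂ × ℂ),
      Tendsto (fun n => A.greenApprox ε L n z) atTop (𝓝 (A.green ε L z))) ∧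
    (∀ z : ℂ × ℂ, Integrable (fun L => A.green ε L z) (Measure.infinitePi fun _ : ℕ => m)) ∧
    (∀ φ, IsTestForm φ →
      Integrable (fun L => A.mu ε L φ) (Measure.infinitePi fun _ : ℕ => m) ∧
      A.avgMu m ε φ = ∫ L, A.mu ε L φ ∂(Measure.infinitePi fun _ : ℕ => m)) ∧
    (∀ (t : M) (L : ℕ → M) (φ : TwoForm), IsTestForm φ →
      pullbackCurrent (A.H t ^ (ε : ℤ)) (A.mu ε L) φ = (A.d : ℂ) * A.mu ε (consSeq t L) φ) ∧
    (∀ z : ℂ × ℂ,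
      Integrable (fun t => A.avgGreen m ε ((A.H t ^ (ε : ℤ)) z)) m ∧
      ∫ t, A.avgGreen m ε ((A.H t ^ (ε : ℤ)) z) ∂m = (A.d : ℝ) * A.avgGreen m ε z) ∧
    (∀ φ, IsTestForm φ →
      Integrable (fun t => pullbackCurrent (A.H t ^ (ε : ℤ)) (A.avgMu m ε) φ) m ∧
      ∫ t, pullbackCurrent (A.H t ^ (ε : ℤ)) (A.avgMu m ε) φ ∂m = (A.d : ℂ) * A.avgMu m ε φ) ∧
    (∀ L : ℕ → M, currentSupport (A.mu ε L) = A.J ε L) ∧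
    LowerHemicontinuous (fun L : ℕ → M => A.J ε L) ∧
    (m.IsOpenPosMeasure → currentSupport (A.avgMu m ε) = closure (⋃ L : ℕ → M, A.J ε L)) := by
  have : CompactSpace M := isCompact_iff_compactSpace.1 hM
  have : Nonempty M := nonempty_of_isProbabilityMeasure m
  obtain ⟨S, hd, hF⟩ := A.exists_escapeSystem ε
  set P : Measure (ℕ → M) := Measure.infinitePi fun _ : ℕ => m with hP
  have hG : ∀ L, A.green ε L = S.G L := A.green_eq hd hF
  have hJ : ∀ L, A.J ε L = frontier (S.K L) := fun L => by rw [HenonFamily.J, A.K_eq hF]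
  have hmu : ∀ L, A.mu ε L = ddcCurrent (S.G L) := fun L => by rw [HenonFamily.mu, hG]
  have havg : A.avgGreen m ε = fun z => ∫ L, S.G L z ∂P := by
    funext z; simp only [HenonFamily.avgGreen, hG, hP]
  have hcont := S.continuous_G
  have hEG : Continuous fun z => ∫ L, S.G L z ∂P := continuous_integral_param P hcont
  have hint : ∀ z, Integrable (fun L => S.G L z) P := fun z =>
    integrable_of_continuous_compactSpace P (Continuous.uncurry_slice hcont z)
  have hHcont : Continuous fun p : M × (ℂ × ℂ) => ∫ L, S.G L ((A.H p.1 ^ (ε : ℤ)) p.2) ∂P := by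
    have h := Continuous.comp (g := fun z => ∫ L, S.G L z ∂P) hEG (A.continuous_H ε)
    exact h
  -- The functional equation turns the left side into `d` times an average of `G` over prepended
  -- sequences, which have the same law as `L`.
  have hinv : ∀ z, ∫ t, (∫ L, S.G L ((A.H t ^ (ε : ℤ)) z) ∂P) ∂m = A.d * ∫ L, S.G L z ∂P := by
    intro z
    have h1 : ∀ t L, S.G L ((A.H t ^ (ε : ℤ)) z) = A.d * S.G (consSeq t L) z := by
      intro t L
      rw [← hF, S.G_comp_F, hd]
    simp only [h1]
    simp_rw [integral_const_mul]
    rw [(integral_consSeq m (hint z)).2]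
  have hsupp : ∀ L, currentSupport (A.mu ε L) = A.J ε L := fun L => by
    rw [hmu, hJ, S.currentSupport_G]
  refine ⟨fun L z => ?_, fun z => ?_, fun φ hφ => ?_, fun t L φ hφ => ?_, fun z => ?_,
    fun φ hφ => ?_, hsupp, ?_, fun hm => ?_⟩
  · rw [hG]; exact A.tendsto_greenApprox hd hF L z
  · simp only [hG]; exact hint z
  · simp only [hmu, HenonFamily.avgMu, havg]
    exact ddcCurrent_integral P hcont hφ
  · rw [hmu, hmu, pullbackCurrent_ddcCurrent (A.contDiff_H_inv ε t) _ hφ.smooth]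
    have h1 : (fun z => S.G L ((A.H t ^ (ε : ℤ)) z)) = fun z => (A.d : ℝ) * S.G (consSeq t L) z := by
      funext z
      rw [← hF, S.G_comp_F, hd]
    rw [h1, ddcCurrent_const_mul]
    simp
  · simp only [havg]
    exact ⟨integrable_of_continuous_compactSpace m (Continuous.uncurry_slice
      (u := fun t z => ∫ L, S.G L ((A.H t ^ (ε : ℤ)) z) ∂P) hHcont z), hinv z⟩
  · have h1 : ∀ t, pullbackCurrent (A.H t ^ (ε : ℤ)) (A.avgMu m ε) φ =
        ddcCurrent (fun z => ∫ L, S.G L ((A.H t ^ (ε : ℤ)) z) ∂P) φ := by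
      intro t
      rw [HenonFamily.avgMu, havg,
        pullbackCurrent_ddcCurrent (A.contDiff_H_inv ε t) _ hφ.smooth]
    obtain ⟨h2, h3⟩ := ddcCurrent_integral m
      (u := fun t z => ∫ L, S.G L ((A.H t ^ (ε : ℤ)) z) ∂P) hHcont hφ
    simp only [h1]
    refine ⟨h2, ?_⟩
    rw [← h3]
    simp only [hinv]
    rw [ddcCurrent_const_mul, HenonFamily.avgMu, havg]
    simp
  · simp only [hJ]; exact S.lowerHemicontinuous_frontier_K
  · have hpos : P.IsOpenPosMeasure := isOpenPosMeasure_infinitePi m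
    rw [HenonFamily.avgMu, havg]
    simp only [hJ]
    -- A ball missing every `J_L` carries no mass of any `μ_L`, hence none of the average.
    -- Conversely, if the average current vanishes on `U`, the mean value equality descends to each
    -- `G_L`, and then `U` meets no `J_L`.
    refine Set.Subset.antisymm (fun z hz => ?_) (fun z hz U hU hzU => ?_)
    · by_contra hcon
      obtain ⟨r, hr, hrU⟩ := Metric.isOpen_iff.1 isClosed_closure.isOpen_compl z hcon
      obtain ⟨φ, hφ, hsub, hne⟩ := hz _ Metric.isOpen_ball (Metric.mem_ball_self hr)
      refine hne ?_
      rw [(ddcCurrent_integral P hcont hφ).2]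
      have h0 : ∀ L, ddcCurrent (S.G L) φ = 0 := fun L =>
        S.ddcCurrent_G_eq_zero_of_disjoint (convex_ball z r).isPreconnected
          (Set.disjoint_left.2 fun w hw hw' =>
            hrU hw (subset_closure (Set.mem_iUnion.2 ⟨L, hw'⟩))) hφ hsub
      simp [h0]
    · by_contra! hcon
      obtain ⟨w, hwU, hw⟩ := mem_closure_iff.1 hz U hU hzU
      obtain ⟨L, hL⟩ := Set.mem_iUnion.1 hw
      obtain ⟨h1, h2⟩ := meanEq_of_ddcCurrent_eq_zero hEG hU hcon
      have hsub : ∀ v (L : ℕ → M) z r, 0 < r →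
          S.G L z ≤ Real.circleAverage (fun w => S.G L (z + w • v)) 0 r :=
        fun v L z r hr => S.G_le_circleAverage L z v hr
      exact S.notMem_frontier_of_meanEq hU (MeanEq.of_integral P hcont (hsub _) h1 L)
        (MeanEq.of_integral P hcont (hsub _) h2 L) hwU hL
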